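/- Let $\kappa$ be a regular uncountable cardinal, and for a cardinal $\rho$ let $\rho^{<\kappa}=\sup_{\nu<\kappa}\rho^{\nu}$ ($\nu$ ranging over cardinals). **Definitions.** A *$\kappa$-suitable model* is a transitive set $M\subseteq H(\kappa^+)$ with $\kappa\in M$ which satisfies $\mathrm{ZFC}^-$ (ZFC without power set, with collection and the well-ordering principle) and is closed under sequences of length less than $\kappa$. For $A,B\subseteq\kappa$ write $A\subseteq^*B$ if $A\setminus B$ is bounded in $\kappa$. A filter on $\kappa$ is *uniform* if all its members have size $\kappa$. An *$M$-ultrafilter* on $\kappa$ is an ultrafilter on the Boolean algebra $P(\kappa)\cap M$; it is *$\kappa$-complete* if the intersection of fewer than $\kappa$ of its members is nonempty, and *$M$-normal* if it contains $\Delta_{\alpha<\kappa}A_\alpha=\{\beta<\kappa\mid\forall\alpha<\beta\ (\beta\in A_\alpha)\}$ for every sequence $\langle A_\alpha\mid\alpha<\kappa\rangle\in M$ of its members. Let $\mathrm{Set}(M)$ (respectively $\mathrm{NSet}(M)$) be the collection of all $\kappa$-complete uniform filters $F$ on $\kappa$ such that $F=\{A\subseteq\kappa\mid X\subseteq^*A\}$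 for some $X\subseteq\kappa$, and $F\cap M$ is a $\kappa$-complete $M$-ultrafilter (respectively an $M$-normal $M$-ultrafilter). For $\mathcal C\in\{\mathrm{Set},\mathrm{NSet}\}$ and an ordinal $\gamma$, in the game $G_{\mathcal C}(\kappa,\gamma)$, at each stage $i<\gamma$, Player I plays a $\kappa$-suitable model $M_i\supseteq\bigcup_{j<i}M_j$ with $|M_i|\le\max(\kappa,|i|)$, and then Player II plays a filter $F_i\in\mathcal C(M_i)$ with $F_i\supseteq\bigcup_{j<i}F_j$. Player I wins if and only if at some stage $i<\gamma$, reached by legal moves, Player I has made a legal move $M_i$ and Player II has no legal reply; in particular, Player II wins a run in which Player I at some stage has no legal move. An ultrafilter $U$ on $\kappa$ is a *$P_\mu$-point* if it is uniform and for every $\mathcal A\subseteq U$ with $|\mathcal A|<\mu$ there is $B\in U$ with $B\subseteq^*A$ for all $A\in\mathcal A$. Finally, $\mathfrak b_\kappa$ is the least size of a family of functions $\kappa\to\kappa$ that is unbounded with respect to domination on a final segment of $\kappa$. **Proposition.** Consider the statements 1. Player II has a winning strategy in $G_{\mathrm{NSet}}(\kappa,2^\kappa)$. 2. Player II has a winning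 strategy in $G_{\mathrm{Set}}(\kappa,2^\kappa)$. 3. $\kappa$ carries a $P_{2^\kappa}$-point. (a) (3) implies (1), and (1) implies (2). (b) If $\kappa^{<\kappa}=\kappa$, $\rho^{<\kappa}<2^\kappa$ for all cardinals $\rho$ with $\kappa\le\rho<2^\kappa$, and $2^\kappa$ is not a regular limit cardinal, then (1), (2) and (3) are equivalent. (c) Suppose $\kappa^{<\kappa}=\kappa$ and let $\mu$ be a cardinal such that $\rho^{<\kappa}<\mu$ for all regular cardinals $\rho$ with $\kappa\le\rho<\mu$. If Player II has a winning strategy in $G_{\mathrm{Set}}(\kappa,\mu)$, then $\mu\le\mathfrak b_\kappa$. -/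

import Mathlib

open Cardinal

universe u

noncomputable section

namespace FilterGame

/-! ### First-order set theory and the axioms of `ZFC⁻` -/

/-- The only symbol of the language of set theory: one binary relation. -/
inductive SetRel : ℕ → Type
  | mem : SetRel 2

/-- The first-order language of set theory. -/
def setLang : FirstOrder.Language := ⟨fun _ => Empty, SetRel⟩

/-- The structure for the language of set theory with membership relation `E`. -/
@[reducible]
def setStructure {N : Type*} (E : N → N → Prop) : setLang.Structure N where
  funMap := fun f => f.elim
  RelMap | SetRel.mem => fun v => E (v 0) (v 1)

/-- Satisfaction in `(N, E)` of a formula of set theory whose free variables are the parameters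
`Sum.inl i`, interpreted by `v`, and the variables `Sum.inr j`, interpreted by `w`. -/
def Sat {N : Type*} (E : N → N → Prop) {k : ℕ} (φ : setLang.Formula (ℕ ⊕ Fin k))
    (v : ℕ → N) (w : Fin k → N) : Prop :=
  letI := setStructure E
  φ.Realize (Sum.elim v w)

section Abstract

variable {N : Type*} (E : N → N → Prop)

/-- `(N, E)` thinks that `z = {x, y}`. -/
def IsUPair (z x y : N) : Prop := ∀ w, E w z ↔ w = x ∨ w = y

/-- `(N, E)` thinks that `p` is the Kuratowski ordered pair `{{x}, {x, y}}`. -/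
def IsOPair (p x y : N) : Prop := ∀ z, E z p ↔ IsUPair E z x x ∨ IsUPair E z x y

/-- `(N, E)` thinks that `(x, y)` belongs to `r`. -/
def InRel (r x y : N) : Prop := ∃ p, E p r ∧ IsOPair E p x y

/-- `(N, E)` thinks that `r` well-orders `a`. -/
structure WellOrders (r a : N) : Prop where
  irrefl : ∀ x, E x a → ¬ InRel E r x x
  trans : ∀ x y z, E x a → E y a → E z a → InRel E r x y → InRel E r y z → InRel E r x z
  total : ∀ x y, E x a → E y a → InRel E r x y ∨ x = y ∨ InRel E r y x
  least : ∀ b, (∃ x, E x b) → (∀ x, E x b → E x a) →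
    ∃ m, E m b ∧ ∀ x, E x b → ¬ InRel E r x m

/-- `(N, E)` is a model of `ZFC⁻`: all axioms of ZFC except the power set axiom, with the
collection scheme and with choice in the form of the well-ordering principle. -/
structure ModelsZFCMinus : Prop where
  extensionality : ∀ a b, (∀ x, E x a ↔ E x b) → a = b
  foundation : ∀ a, (∃ x, E x a) → ∃ x, E x a ∧ ∀ y, E y x → ¬ E y a
  pairing : ∀ a b, ∃ c, IsUPair E c a b
  union : ∀ a, ∃ b, ∀ x, E x b ↔ ∃ y, E y a ∧ E x y
  infinity : ∃ a, (∃ e, E e a ∧ ∀ x, ¬ E x e) ∧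
    ∀ x, E x a → ∃ y, E y a ∧ ∀ z, E z y ↔ E z x ∨ z = x
  separation : ∀ (φ : setLang.Formula (ℕ ⊕ Fin 1)) (v : ℕ → N) (a : N),
    ∃ b, ∀ x, E x b ↔ E x a ∧ Sat E φ v ![x]
  collection : ∀ (φ : setLang.Formula (ℕ ⊕ Fin 2)) (v : ℕ → N) (a : N),
    (∀ x, E x a → ∃ y, Sat E φ v ![x, y]) →
      ∃ b, ∀ x, E x a → ∃ y, E y b ∧ Sat E φ v ![x, y]
  choice : ∀ a, ∃ r, WellOrders E r a

end Abstract

/-! ### Suitable models -/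

/-- `H(θ)`, the class of all sets hereditarily of cardinality less than `θ`
(their transitive closure has fewer than `θ` elements). -/
def HeredLT (θ : Cardinal.{u}) (x : ZFSet.{u}) : Prop :=
  ∃ t : ZFSet.{u}, t.IsTransitive ∧ x ⊆ t ∧ t.card < θ

/-- `κ`-suitable models: transitive sets `M ⊆ H(κ⁺)` containing `κ` that satisfy `ZFC⁻` and are
closed under sequences of length less than `κ`. -/
structure IsSuitable (κ : Cardinal.{u}) (M : ZFSet.{u}) : Prop where
  transitive : M.IsTransitive
  hered : ∀ x ∈ M, HeredLT (Order.succ κ) x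
  kappa_mem : κ.ord.toZFSet ∈ M
  models : ModelsZFCMinus (fun x y : {x : ZFSet.{u} // x ∈ M} => x.1 ∈ y.1)
  closed : ∀ η < κ.ord, ∀ f : ZFSet.{u}, ZFSet.IsFunc η.toZFSet M f → f ∈ M

/-! ### Subsets of `κ` and filters on `κ` -/

/-- The underlying set of `κ`: the well-ordered type of all ordinals below `κ`. -/
abbrev Pt (κ : Cardinal.{u}) : Type u := κ.ord.ToType

variable {κ : Cardinal.{u}}

/-- A point of `κ` as a von Neumann ordinal. -/
def ptCode (a : Pt κ) : ZFSet.{u} := (a.toOrd : Ordinal.{u}).toZFSet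

/-- A subset of `κ` as a set of von Neumann ordinals. -/
def setCode (A : Set (Pt κ)) : ZFSet.{u} := ZFSet.range (fun a : A => ptCode a.1)

/-- A sequence `⟨A_α | α < κ⟩` of subsets of `κ` as a set of ordered pairs `(α, A_α)`. -/
def seqCode (A : Pt κ → Set (Pt κ)) : ZFSet.{u} :=
  ZFSet.range (fun a : Pt κ => ZFSet.pair (ptCode a) (setCode (A a)))

/-- `A ⊆* B`: the difference `A \ B` is bounded in `κ`. -/
def AlmostSubset (A B : Set (Pt κ)) : Prop := ∃ a : Pt κ, ∀ b ∈ A, a ≤ b → b ∈ B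

/-- A filter on `κ` is uniform if all its members have cardinality `κ`. -/
def IsUniform (F : Filter (Pt κ)) : Prop := ∀ A ∈ F, #A = κ

/-- `P_μ`-points: uniform filters on `κ` that are `μ`-directed under `⊇*`. -/
def IsPPoint (μ : Cardinal.{u}) (F : Filter (Pt κ)) : Prop :=
  IsUniform F ∧ ∀ 𝒜 : Set (Set (Pt κ)), (∀ A ∈ 𝒜, A ∈ F) → #𝒜 < μ →
    ∃ B ∈ F, ∀ A ∈ 𝒜, AlmostSubset B A

/-- `κ` carries a `P_μ`-point ultrafilter. -/
def CarriesPPoint (κ μ : Cardinal.{u}) : Prop :=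
  ∃ U : Ultrafilter (Pt κ), IsPPoint μ (U : Filter (Pt κ))

/-- The algebra `P(κ) ∩ M`. -/
def powerIn (κ : Cardinal.{u}) (M : ZFSet.{u}) : Set (Set (Pt κ)) := {A | setCode A ∈ M}

/-- `D` is an `M`-ultrafilter on `κ`, i.e. an ultrafilter on the Boolean algebra `P(κ) ∩ M`. -/
structure IsMUltrafilter (M : ZFSet.{u}) (D : Set (Set (Pt κ))) : Prop where
  subset : D ⊆ powerIn κ M
  univ_mem : Set.univ ∈ D
  empty_notMem : ∅ ∉ D
  inter_mem : ∀ A ∈ D, ∀ B ∈ D, A ∩ B ∈ D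
  up_closed : ∀ A ∈ D, ∀ B ∈ powerIn κ M, A ⊆ B → B ∈ D
  ultra : ∀ A ∈ powerIn κ M, A ∈ D ∨ Aᶜ ∈ D

/-- `κ`-completeness of an `M`-ultrafilter: fewer than `κ` members have nonempty intersection. -/
def IsKappaComplete (D : Set (Set (Pt κ))) : Prop :=
  ∀ 𝒜 : Set (Set (Pt κ)), 𝒜 ⊆ D → #𝒜 < κ → (⋂₀ 𝒜).Nonempty

/-- The diagonal intersection `{β < κ | ∀ α < β, β ∈ A_α}`. -/
def diagInter (A : Pt κ → Set (Pt κ)) : Set (Pt κ) := {b | ∀ a, a < b → b ∈ A a}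

/-- `M`-normality: closure under diagonal intersections of sequences that belong to `M`. -/
def IsMNormal (M : ZFSet.{u}) (D : Set (Set (Pt κ))) : Prop :=
  ∀ A : Pt κ → Set (Pt κ), (∀ a, A a ∈ D) → seqCode A ∈ M → diagInter A ∈ D

/-- `F ∩ M`. -/
def restrict (F : Filter (Pt κ)) (M : ZFSet.{u}) : Set (Set (Pt κ)) :=
  {A | A ∈ F ∧ setCode A ∈ M}

/-- `F` is `⊆*`-generated by a single set. -/
def SinglyGenerated (F : Filter (Pt κ)) : Prop :=
  ∃ X : Set (Pt κ), ∀ A, A ∈ F ↔ AlmostSubset X A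

/-! ### The filter games -/

/-- The constraint function `Set`. -/
def SetC (κ : Cardinal.{u}) (M : ZFSet.{u}) : Set (Filter (Pt κ)) :=
  {F | CardinalInterFilter F κ ∧ IsUniform F ∧ IsMUltrafilter M (restrict F M) ∧
    IsKappaComplete (restrict F M) ∧ SinglyGenerated F}

/-- The constraint function `NSet`. -/
def NSetC (κ : Cardinal.{u}) (M : ZFSet.{u}) : Set (Filter (Pt κ)) :=
  {F | CardinalInterFilter F κ ∧ IsUniform F ∧ IsMUltrafilter M (restrict F M) ∧
    IsMNormal M (restrict F M) ∧ SinglyGenerated F}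

/-- Given the moves `M_j` for `j < i`, the move `M_i` of Player I is legal: it is a `κ`-suitable
model of size at most `max κ |i|` that includes all the previous models. -/
def LegalI (κ : Cardinal.{u}) (M : Ordinal.{u} → ZFSet.{u}) (i : Ordinal.{u}) : Prop :=
  IsSuitable κ (M i) ∧ (M i).card ≤ max κ i.card ∧ ∀ j < i, M j ⊆ M i

/-- The reply `F_i` of Player II to `M_i` is legal: it belongs to `C(M_i)` and extends all the
previous filters. -/
def LegalII (C : ZFSet.{u} → Set (Filter (Pt κ))) (M : Ordinal.{u} → ZFSet.{u})
    (F : Ordinal.{u} → Filter (Pt κ)) (i : Ordinal.{u}) : Prop :=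
  F i ∈ C (M i) ∧ ∀ j < i, ∀ A, A ∈ F j → A ∈ F i

/-- A strategy for Player II: the filter played at stage `i` is determined by the moves of
Player I up to and including stage `i`. -/
abbrev StrategyII (κ : Cardinal.{u}) : Type (u + 1) :=
  (i : Ordinal.{u}) → (Set.Iic i → ZFSet.{u}) → Filter (Pt κ)

/-- The moves of Player II when following `σ` against the moves `M` of Player I. -/
def StrategyII.play (σ : StrategyII κ) (M : Ordinal.{u} → ZFSet.{u}) (i : Ordinal.{u}) :
    Filter (Pt κ) :=
  σ i (fun j => M j.1)

/-- Player II has a winning strategy in the game of length `γ` with constraint function `C`: there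
is a strategy that gives Player II a legal reply at every stage `i < γ`, as long as Player I has
made legal moves up to stage `i`. -/
def IIWins (κ : Cardinal.{u}) (C : ZFSet.{u} → Set (Filter (Pt κ))) (γ : Ordinal.{u}) : Prop :=
  ∃ σ : StrategyII κ, ∀ M : Ordinal.{u} → ZFSet.{u}, ∀ i < γ,
    (∀ j ≤ i, LegalI κ M j) → LegalII C M (σ.play M) i

/-! ### The bounding number -/

/-- `f ≤* g`: `f` is bounded by `g` on a final segment of `κ`. -/
def EventuallyLE (f g : Pt κ → Pt κ) : Prop := ∃ a, ∀ b, a ≤ b → f b ≤ g b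

/-- `𝔟_κ`, the least size of a `≤*`-unbounded family of functions from `κ` to `κ`. -/
def boundingNumber (κ : Cardinal.{u}) : Cardinal.{u} :=
  sInf {c | ∃ S : Set (Pt κ → Pt κ), #S = c ∧ ¬ ∃ g, ∀ f ∈ S, EventuallyLE f g}

end FilterGame

end

noncomputable section

namespace FilterGame

/-! ### Bounded subsets of a regular cardinal -/

section Basic

variable {κ : Cardinal.{u}}

/-! From (3) to (1): a `P_μ`-point with `κ < μ` can be made normal. Among the functions that exceed
every constant on a set of the ultrafilter take one, `h`, that is least modulo the ultrafilter; the
image under `h` is normal and still a `P_μ`-point (`exists_normal_pPoint`). Player II then answers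
`M_i` with the filter generated by some `B_i ∈ U` that is almost included in every member of `U`
from `M_i` and in all earlier `B_j`. These are fewer than `μ` sets, so `B_i` exists (`tower_spec`).
That (1) implies (2) is an inclusion between the two constraint functions.

For (c), suppose `𝔟_κ < μ` and let `S` be an unbounded family of size `𝔟_κ`. As `𝔟_κ` is regular, `θ
= 𝔟_κ^{<κ}` is below `μ`, and Player I can present a suitable model of size `θ` that contains any
`θ` given subsets of `κ`. The reply need not be normal, but the least-function argument works for
any `κ`-complete filter that decides the relevant sets (`exists_minimal_preimage_diagInter_mem`). It
gives `h` such that, for the generator `X` of the reply, `h '' X` is unbounded and almost included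
in the set of closure points of each `f ∈ S`. The function sending `a` to an element of `h '' X`
above `a` then dominates all of `S`, a contradiction (`le_boundingNumber_of_iIWins`).

For (2) to (3), part (c) with `μ = 2^κ` yields `𝔟_κ = 2^κ`, so `2^κ` is regular; not being a regular
limit, it is a successor `ρ⁺`, and `ρ^{<κ} = ρ`. Player I can therefore play models of size at most
`ρ` that exhaust `P(κ)`. The union of the replies is an ultrafilter, and by regularity any fewer
than `2^κ` of its members lie in one `F_i`, whose generator is almost included in all of them
(`carriesPPoint_of_iIWins`).

Suitable models come from closing sets of parameters in `H(κ⁺)` under Skolem functions and sequences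
shorter than `κ` (`hull_spec`, `isSuitable_of_forall_mem_iff`). -/

theorem mk_pt (κ : Cardinal.{u}) : #(Pt κ) = κ := mk_ord_toType κ

theorem mk_Iio_pt_lt (a : Pt κ) : #(Set.Iio a) < κ := by
  simpa only [mk_pt] using mk_Iio_lt a (by simp)

theorem exists_lt_of_mk_lt (hreg : κ.IsRegular) (s : Set (Pt κ)) (hs : #s < κ) :
    ∃ a, ∀ b ∈ s, b < a := by
  by_contra! h
  have hc : IsCofinal s := fun a => by
    obtain ⟨b, hb, hab⟩ := h a
    exact ⟨b, hb, hab⟩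
  have := Order.cof_le hc
  rw [Ordinal.cof_toType, hreg.cof_ord] at this
  exact absurd hs (not_lt.2 this)

theorem exists_forall_lt_of_mk_lt (hreg : κ.IsRegular) {ι : Type u} (hι : #ι < κ)
    (f : ι → Pt κ) : ∃ a, ∀ i, f i < a := by
  obtain ⟨a, ha⟩ := exists_lt_of_mk_lt hreg (Set.range f) (mk_range_le.trans_lt hι)
  exact ⟨a, fun i => ha _ ⟨i, rfl⟩⟩

theorem pt_nonempty (hreg : κ.IsRegular) : Nonempty (Pt κ) := by
  rw [← mk_ne_zero_iff, mk_pt]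
  exact hreg.ne_zero

theorem exists_pt_gt (hreg : κ.IsRegular) (a : Pt κ) : ∃ b, a < b := by
  obtain ⟨b, hb⟩ := exists_lt_of_mk_lt hreg {a} (by
    rw [mk_singleton]; exact_mod_cast hreg.nat_lt 1)
  exact ⟨b, hb a rfl⟩

theorem mk_Iic_pt_lt (hreg : κ.IsRegular) (a : Pt κ) : #(Set.Iic a) < κ := by
  obtain ⟨b, hb⟩ := exists_pt_gt hreg a
  exact (mk_le_mk_of_subset fun x hx => lt_of_le_of_lt hx hb).trans_lt (mk_Iio_pt_lt b)

theorem mk_lt_of_bounded {s : Set (Pt κ)} (a : Pt κ) (h : ∀ b ∈ s, b < a) : #s < κ :=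
  (mk_le_mk_of_subset h).trans_lt (mk_Iio_pt_lt a)

theorem exists_ge_of_mk_eq {s : Set (Pt κ)} (h : #s = κ) (a : Pt κ) : ∃ b ∈ s, a ≤ b := by
  by_contra! hb
  exact (mk_lt_of_bounded a hb).ne h

theorem mk_eq_of_unbounded (hreg : κ.IsRegular) {s : Set (Pt κ)}
    (h : ∀ a, ∃ b ∈ s, a ≤ b) : #s = κ := by
  refine le_antisymm ((mk_set_le s).trans (mk_pt κ).le) ?_
  by_contra! hs
  obtain ⟨a, ha⟩ := exists_lt_of_mk_lt hreg s hs
  obtain ⟨b, hb, hab⟩ := h a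
  exact (ha b hb).not_ge hab

/-! ### Almost inclusion and the filters generated by one set -/

theorem AlmostSubset.refl (hreg : κ.IsRegular) (A : Set (Pt κ)) : AlmostSubset A A := by
  obtain ⟨a⟩ := pt_nonempty hreg
  exact ⟨a, fun b hb _ => hb⟩

theorem AlmostSubset.trans {A B C : Set (Pt κ)} (h : AlmostSubset A B) (h' : AlmostSubset B C) :
    AlmostSubset A C := by
  obtain ⟨a, ha⟩ := h
  obtain ⟨b, hb⟩ := h'
  exact ⟨max a b, fun c hc hab => hb c (ha c hc ((le_max_left _ _).trans hab))
    ((le_max_right _ _).trans hab)⟩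

theorem AlmostSubset.mono {A B C : Set (Pt κ)} (h : AlmostSubset A B) (h' : B ⊆ C) :
    AlmostSubset A C := by
  obtain ⟨a, ha⟩ := h
  exact ⟨a, fun c hc hac => h' (ha c hc hac)⟩

theorem almostSubset_sInter (hreg : κ.IsRegular) {X : Set (Pt κ)} {S : Set (Set (Pt κ))}
    (hS : #S < κ) (h : ∀ A ∈ S, AlmostSubset X A) : AlmostSubset X (⋂₀ S) := by
  choose f hf using fun A : S => h A.1 A.2
  obtain ⟨a, ha⟩ := exists_forall_lt_of_mk_lt hreg hS f
  exact ⟨a, fun b hb hab A hA => hf ⟨A, hA⟩ b hb ((ha ⟨A, hA⟩).le.trans hab)⟩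

/-- The image of a bounded set is bounded, so images preserve almost inclusion. -/
theorem AlmostSubset.image (hreg : κ.IsRegular) {X A : Set (Pt κ)} (h : Pt κ → Pt κ)
    (hX : AlmostSubset X (h ⁻¹' A)) : AlmostSubset (h '' X) A := by
  obtain ⟨a, ha⟩ := hX
  obtain ⟨b, hb⟩ := exists_lt_of_mk_lt hreg (h '' Set.Iio a) (mk_image_le.trans_lt (mk_Iio_pt_lt a))
  refine ⟨b, ?_⟩
  rintro _ ⟨x, hx, rfl⟩ hbx
  exact ha x hx (not_lt.1 fun hxa => (hb _ ⟨x, hxa, rfl⟩).not_ge hbx)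

/-- The filter of all sets that almost include `X`. -/
def genFilter (hreg : κ.IsRegular) (X : Set (Pt κ)) : Filter (Pt κ) where
  sets := {A | AlmostSubset X A}
  univ_sets := (AlmostSubset.refl hreg X).mono (Set.subset_univ _)
  sets_of_superset h h' := h.mono h'
  inter_sets {A B} hA hB := by
    obtain ⟨a, ha⟩ := hA
    obtain ⟨b, hb⟩ := hB
    exact ⟨max a b, fun c hc hab => ⟨ha c hc ((le_max_left _ _).trans hab),
      hb c hc ((le_max_right _ _).trans hab)⟩⟩

theorem cardinalInterFilter_genFilter (hreg : κ.IsRegular) (X : Set (Pt κ)) :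
    CardinalInterFilter (genFilter hreg X) κ :=
  ⟨fun _ hS h => almostSubset_sInter hreg hS h⟩

theorem isUniform_genFilter (hreg : κ.IsRegular) {X : Set (Pt κ)} (hX : #X = κ) :
    IsUniform (genFilter hreg X) := by
  rintro A ⟨a, ha⟩
  refine mk_eq_of_unbounded hreg fun b => ?_
  obtain ⟨c, hc, hbc⟩ := exists_ge_of_mk_eq hX (max a b)
  exact ⟨c, ha c hc ((le_max_left _ _).trans hbc), (le_max_right _ _).trans hbc⟩

theorem IsUniform.neBot (hreg : κ.IsRegular) {F : Filter (Pt κ)} (hF : IsUniform F) : F.NeBot := by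
  refine ⟨fun h => ?_⟩
  have : #(∅ : Set (Pt κ)) = κ := hF ∅ (by simp [h])
  rw [mk_eq_zero] at this
  exact hreg.ne_zero this.symm

theorem IsUniform.Ici_mem {U : Ultrafilter (Pt κ)} (hU : IsUniform (U : Filter (Pt κ)))
    (a : Pt κ) : Set.Ici a ∈ U := by
  by_contra h
  have h' := Ultrafilter.compl_mem_iff_notMem.2 h
  refine (mk_lt_of_bounded (s := (Set.Ici a)ᶜ) a fun b hb => ?_).ne (hU _ h')
  simpa using hb

end Basic

/-! ### Least unbounded functions modulo a filter -/

section Minimal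

variable {κ : Cardinal.{u}}

/-- Countable completeness, available because `κ` is uncountable, turns a descending sequence modulo
`F` into a descending sequence of ordinals at a single point. -/
theorem wellFounded_eventually_lt {F : Filter (Pt κ)} [F.NeBot] (hunc : ℵ₀ < κ)
    [CardinalInterFilter F κ] :
    WellFounded fun f g : Pt κ → Pt κ => {x | f x < g x} ∈ F := by
  have : CountableInterFilter F := CardinalInterFilter.toCountableInterFilter F hunc
  rw [wellFounded_iff_isEmpty_descending_chain]
  refine ⟨fun ⟨f, hf⟩ => ?_⟩
  have h : ∀ᶠ x in F, ∀ n, f (n + 1) x < f n x := eventually_countable_forall.2 hf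
  obtain ⟨x, hx⟩ := h.exists
  exact (wellFounded_iff_isEmpty_descending_chain.1
    (wellFounded_lt (α := Pt κ))).false ⟨fun n => f n x, hx⟩

open Classical in
/-- If `h ξ` is not in the diagonal intersection of the `A a`, the least `a < h ξ` witnessing
this. -/
def regress (A : Pt κ → Set (Pt κ)) (h : Pt κ → Pt κ) (x : Pt κ) : Pt κ :=
  if hx : ∃ a, a < h x ∧ h x ∉ A a then
    WellFounded.min (wellFounded_lt (α := Pt κ)) {a | a < h x ∧ h x ∉ A a} hx
  else h x

theorem regress_spec (A : Pt κ → Set (Pt κ)) (h : Pt κ → Pt κ) {x : Pt κ}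
    (hx : h x ∉ diagInter A) : regress A h x < h x ∧ h x ∉ A (regress A h x) := by
  have hx' : ∃ a, a < h x ∧ h x ∉ A a := by
    simpa [diagInter] using hx
  rw [regress, dif_pos hx']
  exact WellFounded.min_mem (wellFounded_lt (α := Pt κ)) {a | a < h x ∧ h x ∉ A a} hx'

/-- Normalisation for a filter that decides only certain sets. Take `h` least modulo `F` among the
functions in `𝓕` that exceed every constant. If a preimage of a diagonal intersection failed to be
in `F`, then `regress A h` would be smaller than `h` on a set in `F`, hence by minimality bounded
there by a constant `a`. The intersection of the `h ⁻¹' A b` over `b ≤ a` is in `F` by completeness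
and contradicts the choice of `regress`. -/
theorem exists_minimal_preimage_diagInter_mem (hreg : κ.IsRegular) (hunc : ℵ₀ < κ)
    {F : Filter (Pt κ)} [F.NeBot] [CardinalInterFilter F κ] (𝓕 : Set (Pt κ → Pt κ))
    (𝒮 : Set (Pt κ → Set (Pt κ)))
    (hid : id ∈ 𝓕) (hIci : ∀ a : Pt κ, Set.Ici a ∈ F)
    (hcl : ∀ h ∈ 𝓕, ∀ A ∈ 𝒮, regress A h ∈ 𝓕)
    (hdec : ∀ h ∈ 𝓕, ∀ a, {x | h x ≤ a} ∈ F ∨ {x | h x ≤ a}ᶜ ∈ F)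
    (hdec' : ∀ h ∈ 𝓕, ∀ A ∈ 𝒮, h ⁻¹' diagInter A ∈ F ∨ (h ⁻¹' diagInter A)ᶜ ∈ F) :
    ∃ h ∈ 𝓕, (∀ a, {x | a < h x} ∈ F) ∧
      ∀ A ∈ 𝒮, (∀ a, h ⁻¹' A a ∈ F) → h ⁻¹' diagInter A ∈ F := by
  let W : Set (Pt κ → Pt κ) := {h | h ∈ 𝓕 ∧ ∀ a, {x | a < h x} ∈ F}
  have hW : W.Nonempty := ⟨id, hid, fun a => by
    obtain ⟨b, hb⟩ := exists_pt_gt hreg a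
    exact Filter.mem_of_superset (hIci b) fun x hx => lt_of_lt_of_le hb hx⟩
  have wf := wellFounded_eventually_lt (F := F) hunc
  have hmem := WellFounded.min_mem wf W hW
  set h := WellFounded.min wf W hW with hh
  refine ⟨h, hmem.1, hmem.2, fun A hA hAF => ?_⟩
  refine (hdec' h hmem.1 A hA).resolve_right fun hc => ?_
  have hr := hcl h hmem.1 A hA
  have hlt : {x | regress A h x < h x} ∈ F :=
    Filter.mem_of_superset hc fun x hx => (regress_spec A h hx).1
  have hnot : ¬ regress A h ∈ W := fun hw => WellFounded.not_lt_min wf W hw hlt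
  have : ∃ a, {x | regress A h x ≤ a} ∈ F := by
    by_contra! hn
    refine hnot ⟨hr, fun a => ?_⟩
    refine Filter.mem_of_superset ((hdec _ hr a).resolve_left (hn a)) fun x hx => ?_
    simpa using hx
  obtain ⟨a, ha⟩ := this
  have hI : (⋂ b : Set.Iic a, h ⁻¹' A b) ∈ F :=
    (Filter.cardinal_iInter_mem (mk_Iic_pt_lt hreg a)).2 fun b => hAF b
  obtain ⟨x, ⟨hx1, hx2⟩, hx3⟩ := F.nonempty_of_mem
    (Filter.inter_mem (Filter.inter_mem ha hI) hc)
  exact (regress_spec A h hx3).2 (Set.mem_iInter.1 hx2 ⟨_, hx1⟩)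

end Minimal

/-! ### Closure under operations -/

section Closure

universe v

variable {X : Type v} {α : Type u} {β : α → Type u} (op : ∀ a, (β a → X) → X)

/-- The closure of `S` under the operations `op`. -/
inductive GenBy (S : Set X) : X → Prop
  | base (x : X) : x ∈ S → GenBy S x
  | app (a : α) (f : β a → X) : (∀ b, GenBy S (f b)) → GenBy S (op a f)

theorem GenBy.mono {S T : Set X} (hST : S ⊆ T) {x : X} (hx : GenBy op S x) : GenBy op T x := by
  induction hx with
  | base x hx => exact .base x (hST hx)
  | app a f _ ih => exact .app a f ih

/-- Every element of the closure is the value of a well-founded term: leaves are indexed by `ι`,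
inner nodes by operations. The type of terms lives in the small universe even when `X` does not, and
has at most `θ` elements because `θ` absorbs the powers given by the arities. -/
theorem exists_genBy_surjection {S : Set X} {ι : Type u} (c : ι → X) (hc : S ⊆ Set.range c)
    {θ : Cardinal.{u}} (hθ : ℵ₀ ≤ θ) (hι : #ι ≤ θ) (hα : #α ≤ θ)
    (hβ : ∀ a, θ ^ #(β a) ≤ θ) :
    ∃ (T : Type u) (e : T → X), #T ≤ θ ∧ ∀ x, GenBy op S x → x ∈ Set.range e := by
  let B : ι ⊕ α → Type u := Sum.elim (fun _ => PEmpty) β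
  let ev : WType B → X := fun t => WType.elim X
    (fun p : Σ a, (B a → X) => match p with
      | ⟨.inl i, _⟩ => c i
      | ⟨.inr a, f⟩ => op a f) t
  refine ⟨WType B, ev, WType.cardinalMk_le_of_le ?_, fun x hx => ?_⟩
  · refine (sum_le_sum _ (fun _ => θ) ?_).trans ?_
    · rintro (i | a)
      · simpa [B] using one_le_aleph0.trans hθ
      · exact hβ a
    · rw [sum_const', mk_sum, lift_id, lift_id]
      exact (mul_le_mul_left (add_le_of_le hθ hι hα) θ).trans (mul_eq_self hθ).le
  · induction hx with
    | base x hx =>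
      obtain ⟨i, rfl⟩ := hc hx
      exact ⟨WType.mk (Sum.inl i) PEmpty.elim, rfl⟩
    | app a f _ ih =>
      choose g hg using ih
      refine ⟨WType.mk (Sum.inr a) g, ?_⟩
      change op a (fun b => ev (g b)) = _
      simp only [hg]

end Closure

/-! ### Weak powers of cardinals. -/

section CardinalArithmetic

variable {κ : Cardinal.{u}}

theorem power_le_of_powerlt_eq {θ ν : Cardinal.{u}} (h : θ ^< κ = θ) (hν : ν < κ) : θ ^ ν ≤ θ :=
  (le_powerlt θ hν).trans h.le

/-- The weak power `ρ ^< κ` of a regular `κ` is closed under powers below `κ`. -/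
theorem powerlt_power_le (hreg : κ.IsRegular) {ρ ν : Cardinal.{u}} (hρ : κ ≤ ρ) (hν : ν < κ) :
    (ρ ^< κ) ^ ν ≤ ρ ^< κ := by
  set θ := ρ ^< κ with hθ
  have h1 : ρ ≤ θ := by
    simpa using le_powerlt ρ (show (1 : Cardinal) < κ by exact_mod_cast hreg.nat_lt 1)
  have hκθ : κ ≤ θ := hρ.trans h1
  have hinf : ℵ₀ ≤ θ := hreg.aleph0_le.trans hκθ
  have hρ2 : (2 : Cardinal) ≤ ρ := (by exact_mod_cast (hreg.nat_lt 2).le : (2 : Cardinal) ≤ κ).trans hρ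
  let R : Type u := ρ.out
  have hR : #R = ρ := mk_out ρ
  have hsig : ∀ τ : Cardinal.{u}, τ < κ →
      #(Σ a : Pt κ, (τ.out × Set.Iio a → R)) ≤ θ := by
    intro τ hτ
    rw [mk_sigma]
    refine (sum_le_sum _ (fun _ => θ) fun a => ?_).trans ?_
    · rw [mk_arrow, lift_id, lift_id, hR]
      refine le_powerlt ρ ?_
      rw [mk_prod, lift_id, lift_id, mk_out]
      exact mul_lt_of_lt hreg.aleph0_le hτ (mk_Iio_pt_lt a)
    · rw [sum_const', mk_pt]
      exact (mul_le_mul_left hκθ θ).trans (mul_eq_self hinf).le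
  let P : Type u := Σ a : Pt κ, (Set.Iio a → R)
  -- Each `τ < κ` is the size of an initial segment `Set.Iio a`, with `a` the point of order type
  -- `τ.ord`, so `P` contains a copy of each `τ → R`.
  have hP : θ ≤ #P := by
    rw [hθ, powerlt_le]
    intro τ hτ
    have hlt : τ.ord < κ.ord := ord_lt_ord.2 hτ
    let a : Pt κ := Ordinal.ToType.mk ⟨τ.ord, hlt⟩
    have ha : #(Set.Iio a) = τ := by
      have h := Ordinal.card_typein (r := LT.lt) a
      rw [show Ordinal.typein LT.lt a = τ.ord from Ordinal.typein_enum _ _, card_ord] at h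
      exact h.symm
    rw [← ha, ← hR, ← lift_id #R, ← lift_id #(Set.Iio a), ← mk_arrow]
    exact mk_le_of_injective (f := fun g => (⟨a, g⟩ : P)) fun g g' h => by
      simpa [P] using h
  calc θ ^ ν ≤ #P ^ #ν.out := by rw [mk_out]; exact power_le_power_right hP
    _ = #(ν.out → P) := by simp
    _ ≤ #((ν.out → Pt κ) × Σ a : Pt κ, (ν.out × Set.Iio a → R)) := by
      have : Nonempty R := by
        rw [← mk_ne_zero_iff, hR]
        exact (lt_of_lt_of_le two_pos hρ2).ne'
      -- By regularity the `ν` many lengths occurring in `f` are below one point `bd f`. So `f` is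
      -- coded by its lengths together with one function on `ν × Set.Iio (bd f)`, padded by an
      -- arbitrary value beyond each length.
      choose bd hbd using fun f : ν.out → P =>
        exists_forall_lt_of_mk_lt hreg (by rwa [mk_out]) fun i => (f i).1
      refine mk_le_of_injective (f := fun f => (fun i => (f i).1, ⟨bd f, fun p =>
        if h : p.2.1 < (f p.1).1 then (f p.1).2 ⟨p.2.1, h⟩ else Classical.arbitrary R⟩)) ?_
      intro f g hfg
      obtain ⟨h1, h2⟩ := Prod.mk.inj hfg
      obtain ⟨h3, h4⟩ := Sigma.mk.inj h2
      have h5 : ∀ i (y : Pt κ) (hf : y < (f i).1) (hg : y < (g i).1),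
          (f i).2 ⟨y, hf⟩ = (g i).2 ⟨y, hg⟩ := by
        intro i y hf hg
        have key : ∀ (a b : Pt κ) (F : ν.out × Set.Iio a → R) (G : ν.out × Set.Iio b → R),
            a = b → HEq F G → ∀ (ha : y < a) (hb : y < b), F (i, ⟨y, ha⟩) = G (i, ⟨y, hb⟩) := by
          rintro a _ F G rfl h _ _
          rw [eq_of_heq h]
        have := key _ _ _ _ h3 h4 (hf.trans (hbd f i)) (hg.trans (hbd g i))
        simpa [hf, hg] using this
      funext i
      have h6 : (f i).1 = (g i).1 := congrFun h1 i
      have key : ∀ p q : P, p.1 = q.1 →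
          (∀ y (hp : y < p.1) (hq : y < q.1), p.2 ⟨y, hp⟩ = q.2 ⟨y, hq⟩) → p = q := by
        rintro ⟨a, p⟩ ⟨b, q⟩ (rfl : a = b) h
        congr 1
        funext y
        exact h y.1 y.2 y.2
      exact key _ _ h6 fun y => h5 i y
    _ ≤ θ := by
      rw [mk_prod, lift_id, lift_id, mk_arrow, lift_id, lift_id, mk_out, mk_pt]
      refine (mul_le_mul' ((power_le_power_right hρ).trans (le_powerlt ρ hν)) (hsig ν hν)).trans
        (mul_eq_self hinf).le

end CardinalArithmetic

/-! ### The bounding number: bounds and regularity. -/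

section Bounding

variable {κ : Cardinal.{u}}

/-- The set of functions `S` has an upper bound modulo bounded sets. -/
def IsBounded (S : Set (Pt κ → Pt κ)) : Prop := ∃ g, ∀ f ∈ S, EventuallyLE f g

theorem not_isBounded_univ (hreg : κ.IsRegular) : ¬ IsBounded (Set.univ : Set (Pt κ → Pt κ)) := by
  rintro ⟨g, hg⟩
  choose s hs using exists_pt_gt hreg
  obtain ⟨a, ha⟩ := hg (fun x => s (g x)) trivial
  exact (ha a le_rfl).not_gt (hs _)

theorem isBounded_of_lt {S : Set (Pt κ → Pt κ)} (h : #S < boundingNumber κ) : IsBounded S := by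
  by_contra hS
  exact h.not_ge (csInf_le' ⟨S, rfl, hS⟩)

theorem exists_unbounded (hreg : κ.IsRegular) :
    ∃ S : Set (Pt κ → Pt κ), #S = boundingNumber κ ∧ ¬ IsBounded S :=
  csInf_mem (s := {c | ∃ S : Set (Pt κ → Pt κ), #S = c ∧ ¬ IsBounded S})
    ⟨_, Set.univ, rfl, not_isBounded_univ hreg⟩

theorem le_boundingNumber (hreg : κ.IsRegular) : κ ≤ boundingNumber κ := by
  obtain ⟨S, hS, hS'⟩ := exists_unbounded hreg
  rw [← hS]
  by_contra! hlt
  choose g hg using fun x : Pt κ => exists_forall_lt_of_mk_lt hreg hlt fun f : S => f.1 x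
  obtain ⟨a⟩ := pt_nonempty hreg
  exact hS' ⟨g, fun f hf => ⟨a, fun b _ => (hg b ⟨f, hf⟩).le⟩⟩

theorem boundingNumber_le (hreg : κ.IsRegular) : boundingNumber κ ≤ 2 ^ κ := by
  refine (csInf_le' (show _ ∈ {c | ∃ S : Set (Pt κ → Pt κ), #S = c ∧ ¬ IsBounded S} from
    ⟨Set.univ, rfl, not_isBounded_univ hreg⟩)).trans ?_
  rw [mk_univ, ← power_def, mk_pt, power_self_eq hreg.aleph0_le]

theorem EventuallyLE.trans {f g h : Pt κ → Pt κ} (h1 : EventuallyLE f g) (h2 : EventuallyLE g h) :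
    EventuallyLE f h := by
  obtain ⟨a, ha⟩ := h1
  obtain ⟨b, hb⟩ := h2
  exact ⟨max a b, fun c hc => (ha c ((le_max_left _ _).trans hc)).trans
    (hb c ((le_max_right _ _).trans hc))⟩

/-- Enumerate an unbounded family in order type `𝔟_κ`. Proper initial segments are bounded; were the
cofinality smaller, the bounds for a cofinal set of segments would have a common bound, which would
bound the whole family. -/
theorem isRegular_boundingNumber (hreg : κ.IsRegular) : (boundingNumber κ).IsRegular := by
  refine ⟨hreg.aleph0_le.trans (le_boundingNumber hreg), ?_⟩
  obtain ⟨S, hS, hS'⟩ := exists_unbounded hreg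
  by_contra! hlt
  rw [← Ordinal.cof_toType] at hlt
  obtain ⟨s, hs, hcard⟩ := Order.exists_cof_eq (boundingNumber κ).ord.ToType
  rw [← hcard] at hlt
  obtain ⟨e⟩ : Nonempty ((boundingNumber κ).ord.ToType ≃ S) := by
    rw [← Cardinal.eq, hS, mk_ord_toType]
  have hpiece : ∀ a : s, IsBounded ((fun b => (e b).1) '' Set.Iic a.1) := fun a => by
    refine isBounded_of_lt (mk_image_le.trans_lt ?_)
    simpa using mk_Iic_lt a.1 (by simp) (by simpa using hreg.aleph0_le.trans (le_boundingNumber hreg))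
  choose g hg using hpiece
  obtain ⟨G, hG⟩ := isBounded_of_lt (mk_range_le.trans_lt hlt : #(Set.range g) < _)
  refine hS' ⟨G, fun f hf => ?_⟩
  obtain ⟨a, ha, hle⟩ := hs (e.symm ⟨f, hf⟩)
  exact (hg ⟨a, ha⟩ f ⟨_, hle, by simp⟩).trans (hG _ ⟨⟨a, ha⟩, rfl⟩)

end Bounding

/-! ### Sets hereditarily of cardinality at most `κ` -/

section Hereditary

variable {κ : Cardinal.{u}}

theorem HeredLT.mono {θ : Cardinal.{u}} {x y : ZFSet.{u}} (hy : HeredLT θ y) (h : x ⊆ y) :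
    HeredLT θ x := by
  obtain ⟨t, ht, hyt, hc⟩ := hy
  exact ⟨t, ht, fun z hz => hyt (h hz), hc⟩

theorem HeredLT.of_mem {θ : Cardinal.{u}} {x y : ZFSet.{u}} (hy : HeredLT θ y) (h : x ∈ y) :
    HeredLT θ x := by
  obtain ⟨t, ht, hyt, hc⟩ := hy
  exact ⟨t, ht, ht x (hyt h), hc⟩

theorem HeredLT.card_lt {θ : Cardinal.{u}} {x : ZFSet.{u}} (hx : HeredLT θ x) : x.card < θ := by
  obtain ⟨t, _, hxt, hc⟩ := hx
  exact (ZFSet.card_mono hxt).trans_lt hc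

theorem card_range_le {ι : Type u} (g : ι → ZFSet.{u}) : (ZFSet.range g).card ≤ #ι := by
  simpa using ZFSet.lift_card_range_le (f := g)

theorem heredLT_range (hκ : ℵ₀ ≤ κ) {ι : Type u} (hι : #ι ≤ κ) {g : ι → ZFSet.{u}}
    (hg : ∀ i, HeredLT (Order.succ κ) (g i)) : HeredLT (Order.succ κ) (ZFSet.range g) := by
  choose t ht hgt hc using hg
  refine ⟨ZFSet.iUnion fun i => insert (g i) (t i), ?_, ?_, ?_⟩
  · refine ZFSet.IsTransitive.iUnion fun i y hy z hz => ?_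
    rcases ZFSet.mem_insert_iff.1 hy with rfl | hy
    · exact ZFSet.mem_insert_of_mem _ (hgt i hz)
    · exact ZFSet.mem_insert_of_mem _ (ht i y hy hz)
  · intro y hy
    obtain ⟨i, rfl⟩ := ZFSet.mem_range.1 hy
    exact ZFSet.mem_iUnion.2 ⟨i, ZFSet.mem_insert _ _⟩
  · rw [Order.lt_succ_iff]
    have h := ZFSet.lift_card_iUnion_le_sum_card (f := fun i => insert (g i) (t i))
    rw [lift_id] at h
    refine h.trans ((sum_le_sum _ (fun _ => κ) fun i => ?_).trans ?_)
    · exact ZFSet.card_insert_le.trans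
        (add_le_of_le hκ (Order.lt_succ_iff.1 (hc i)) (one_le_aleph0.trans hκ))
    · rw [sum_const']
      exact (mul_le_mul_left hι κ).trans (mul_eq_self hκ).le

/-- Indices that code no element get the value `∅`, which is hereditarily small; this keeps the
enumeration total even for empty `x`. -/
theorem exists_enumeration {x : ZFSet.{u}} (hx : x.card ≤ κ) :
    ∃ e : Pt κ → ZFSet.{u}, (∀ y ∈ x, ∃ a, e a = y) ∧ ∀ a, e a ∈ x ∨ e a = ∅ := by
  classical
  rw [ZFSet.card, ← mk_pt κ] at hx
  obtain ⟨i⟩ := hx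
  refine ⟨fun a => if h : ∃ y, i y = a then ((equivShrink x).symm h.choose).1 else ∅,
    fun y hy => ⟨i (equivShrink x ⟨y, hy⟩), ?_⟩, fun a => ?_⟩
  · have h : ∃ z, i z = i (equivShrink x ⟨y, hy⟩) := ⟨_, rfl⟩
    beta_reduce
    rw [dif_pos h, i.injective h.choose_spec]
    simp
  · by_cases h : ∃ y, i y = a
    · simp only [dif_pos h]
      exact .inl (Subtype.prop _)
    · exact .inr (dif_neg h)

theorem heredLT_pair (hκ : ℵ₀ ≤ κ) {x y : ZFSet.{u}} (hx : HeredLT (Order.succ κ) x)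
    (hy : HeredLT (Order.succ κ) y) : HeredLT (Order.succ κ) (ZFSet.pair x y) := by
  have key : ∀ x y : ZFSet.{u}, HeredLT (Order.succ κ) x → HeredLT (Order.succ κ) y →
      HeredLT (Order.succ κ) {x, y} := by
    intro x y hx hy
    refine (heredLT_range hκ (ι := ULift.{u} Bool) (g := fun b => if b.down then x else y)
      (by simpa using (natCast_lt_aleph0 (n := 2)).le.trans hκ) fun b => ?_).mono fun z hz => ?_
    · split <;> assumption
    · rcases ZFSet.mem_pair.1 hz with rfl | rfl
      · exact ZFSet.mem_range.2 ⟨⟨true⟩, by simp⟩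
      · exact ZFSet.mem_range.2 ⟨⟨false⟩, by simp⟩
  refine key _ _ ?_ (key _ _ hx hy)
  exact (key _ _ hx hx).mono fun z hz => by simpa using hz

theorem heredLT_ord {θ : Cardinal.{u}} {o : Ordinal.{u}} (h : o.card < θ) :
    HeredLT θ o.toZFSet :=
  ⟨o.toZFSet, (ZFSet.isOrdinal_toZFSet o).isTransitive, fun _ h => h, by simpa using h⟩

/-- The type of all sets hereditarily of cardinality at most `κ`. -/
abbrev Hered (κ : Cardinal.{u}) : Type (u + 1) := {x : ZFSet.{u} // HeredLT (Order.succ κ) x}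

/-- The membership relation on the subtype of sets satisfying `p`. -/
abbrev memRel (p : ZFSet.{u} → Prop) (x y : {x // p x}) : Prop := x.1 ∈ y.1

end Hereditary

/-! ### Elementarity -/

section Elementary

open FirstOrder

variable {κ : Cardinal.{u}}

/-- The interpretation of formulas in `H(κ⁺)`. -/
instance heredStructure : setLang.Structure (Hered κ) := setStructure (memRel _)

/-- This is the Tarski–Vaught test: witnesses from `H(κ⁺)` can be found in `M`, so the inclusion is
elementary. -/
theorem sat_iff_sat_hered {M : ZFSet.{u}} (hM : ∀ x ∈ M, HeredLT (Order.succ κ) x)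
    (hsk : ∀ (n : ℕ) (φ : setLang.BoundedFormula Empty (n + 1)) (x : Fin n → Hered κ),
      (∀ i, (x i).1 ∈ M) → ∀ a, φ.Realize default (Fin.snoc x a) →
        ∃ a : Hered κ, a.1 ∈ M ∧ φ.Realize default (Fin.snoc x a))
    {k : ℕ} (φ : setLang.Formula (ℕ ⊕ Fin k)) (v : ℕ → {x // x ∈ M}) (w : Fin k → {x // x ∈ M}) :
    Sat (memRel (· ∈ M)) φ v w ↔
      Sat (memRel (HeredLT (Order.succ κ))) φ (fun i => ⟨(v i).1, hM _ (v i).2⟩)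
        (fun i => ⟨(w i).1, hM _ (w i).2⟩) := by
  let _ : setLang.Structure {x // x ∈ M} := setStructure (memRel (· ∈ M))
  let f : {x // x ∈ M} ↪[setLang] Hered κ :=
    { toFun := fun x => ⟨x.1, hM _ x.2⟩
      inj' := fun x y h => Subtype.ext (congrArg (fun z : Hered κ => z.1) h)
      map_fun' := fun g => g.elim
      map_rel' := fun r x => by
        cases r
        rfl }
  have htv := fun (n : ℕ) (φ : setLang.BoundedFormula Empty (n + 1)) (x : Fin n → {x // x ∈ M})
      (a : Hered κ) (h : φ.Realize default (Fin.snoc (f ∘ x) a)) =>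
    show ∃ b : {x // x ∈ M}, φ.Realize default (Fin.snoc (f ∘ x) (f b)) by
      obtain ⟨b, hb, hb'⟩ := hsk n φ (f ∘ x) (fun i => (x i).2) a h
      exact ⟨⟨b.1, hb⟩, hb'⟩
  have h := (f.toElementaryEmbedding htv).map_formula φ (Sum.elim v w)
  rw [Sum.comp_elim] at h
  exact h.symm

instance countable_relations : Countable (Σ n, setLang.Relations n) :=
  (show Function.Injective fun p : Σ n, setLang.Relations n => p.1 by
    rintro ⟨_, ⟨⟩⟩ ⟨_, ⟨⟩⟩ _
    rfl).countable

instance isEmpty_functions : IsEmpty (Σ n, setLang.Functions n) := ⟨fun p => p.2.elim⟩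

instance countable_boundedFormula {α : Type} [Countable α] :
    Countable (Σ n, setLang.BoundedFormula α n) := by
  rw [← mk_le_aleph0_iff]
  refine Language.BoundedFormula.card_le.trans (max_le le_rfl ?_)
  simp only [lift_uzero]
  refine add_le_aleph0.2 ⟨mk_le_aleph0, ?_⟩
  rw [Language.card, Language.Symbols, mk_le_aleph0_iff]
  infer_instance

instance countable_formula {α : Type} [Countable α] : Countable (setLang.Formula α) :=
  (show Function.Injective fun φ : setLang.Formula α =>
      (⟨0, φ⟩ : Σ n, setLang.BoundedFormula α n) from fun φ ψ h => by simpa using h).countable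

end Elementary

/-! ### Suitable hulls -/

section Hull

open FirstOrder

variable {κ : Cardinal.{u}}

/-- The operations under which the hulls are closed. -/
inductive Op (κ : Cardinal.{u}) : Type u
  | enum (a : Pt κ)
  | range (a : Pt κ)
  | union
  | wellOrder
  | sep (φ : setLang.Formula (ℕ ⊕ Fin 1))
  | coll (φ : setLang.Formula (ℕ ⊕ Fin 2))
  | skolem (n : ℕ) (φ : setLang.BoundedFormula Empty (n + 1))

/-- The index type of the arguments of an operation. -/
def Op.arity : Op κ → Type u
  | .enum _ => PUnit
  | .range a => Set.Iio a
  | .union => PUnit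
  | .wellOrder => PUnit
  | .sep _ => ULift ℕ
  | .coll _ => ULift ℕ
  | .skolem _ _ => ULift ℕ

theorem mk_op_le (hκ : ℵ₀ ≤ κ) : #(Op κ) ≤ κ := by
  let C : Type := Option (Option (setLang.Formula (ℕ ⊕ Fin 1) ⊕ setLang.Formula (ℕ ⊕ Fin 2) ⊕
    Σ n, setLang.BoundedFormula Empty n))
  let f : Op κ → (Pt κ ⊕ Pt κ) ⊕ ULift.{u} C := fun o => match o with
    | .enum a => .inl (.inl a)
    | .range a => .inl (.inr a)
    | .union => .inr ⟨none⟩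
    | .wellOrder => .inr ⟨some none⟩
    | .sep φ => .inr ⟨some (some (.inl φ))⟩
    | .coll φ => .inr ⟨some (some (.inr (.inl φ)))⟩
    | .skolem n φ => .inr ⟨some (some (.inr (.inr ⟨n + 1, φ⟩)))⟩
  have hf : Function.Injective f := by
    intro o o' h
    cases o <;> cases o' <;> simp [f] at h ⊢ <;> cases h <;> simp
  refine (mk_le_of_injective hf).trans ?_
  simp only [mk_sum, lift_id, mk_pt]
  exact add_le_of_le hκ (add_le_of_le hκ le_rfl le_rfl) (mk_le_aleph0.trans hκ)

theorem Op.mk_arity_lt (hunc : ℵ₀ < κ) (o : Op κ) : #o.arity < κ := by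
  have h1 : #PUnit.{u+1} < κ := by simpa using one_lt_aleph0.trans hunc
  have h2 : #(ULift.{u} ℕ) < κ := by simpa using hunc
  cases o with
  | range a => exact mk_Iio_pt_lt a
  | _ => assumption

theorem exists_hered_enumeration (x : Hered κ) :
    ∃ e : Pt κ → Hered κ, ∀ y ∈ x.1, ∃ a, (e a).1 = y := by
  obtain ⟨e, he, he'⟩ := exists_enumeration (Order.lt_succ_iff.1 x.2.card_lt)
  have h : ∀ a, HeredLT (Order.succ κ) (e a) := fun a => by
    rcases he' a with ha | ha
    · exact x.2.of_mem ha
    · rw [ha]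
      exact x.2.mono (ZFSet.empty_subset _)
  exact ⟨fun a => ⟨e a, h a⟩, he⟩

/-- An enumeration, of length `κ`, of a superset of a hereditarily small set. -/
def enumHered (x : Hered κ) : Pt κ → Hered κ := (exists_hered_enumeration x).choose

theorem exists_enumHered_eq {x : Hered κ} {y : ZFSet.{u}} (hy : y ∈ x.1) :
    ∃ a, (enumHered x a).1 = y :=
  (exists_hered_enumeration x).choose_spec y hy

theorem heredLT_union {x : ZFSet.{u}} (hx : HeredLT (Order.succ κ) x) :
    HeredLT (Order.succ κ) (ZFSet.sUnion x) := by
  obtain ⟨t, ht, hxt, hc⟩ := hx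
  refine ⟨t, ht, fun y hy => ?_, hc⟩
  obtain ⟨z, hz, hyz⟩ := ZFSet.mem_sUnion.1 hy
  exact ht z (hxt hz) hyz

/-- The code of a well-order of `x`. -/
def wellOrderCode (x : ZFSet.{u}) : ZFSet.{u} :=
  (ZFSet.prod x x).sep fun p => ∃ y z, p = ZFSet.pair y z ∧ WellOrderingRel y z

theorem pair_mem_wellOrderCode {x y z : ZFSet.{u}} (hy : y ∈ x) (hz : z ∈ x) :
    ZFSet.pair y z ∈ wellOrderCode x ↔ WellOrderingRel y z := by
  rw [wellOrderCode, ZFSet.mem_sep, ZFSet.pair_mem_prod]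
  constructor
  · rintro ⟨_, y', z', h, h'⟩
    obtain ⟨rfl, rfl⟩ := ZFSet.pair_injective h
    exact h'
  · exact fun h => ⟨⟨hy, hz⟩, y, z, rfl, h⟩

theorem heredLT_wellOrderCode (hκ : ℵ₀ ≤ κ) (x : Hered κ) :
    HeredLT (Order.succ κ) (wellOrderCode x.1) := by
  refine (heredLT_range hκ (ι := Pt κ × Pt κ)
    (g := fun p => ZFSet.pair (enumHered x p.1).1 (enumHered x p.2).1) ?_ fun p =>
      heredLT_pair hκ (Subtype.prop _) (Subtype.prop _)).mono fun p hp => ?_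
  · rw [mk_prod, lift_id, mk_pt, mul_eq_self hκ]
  · obtain ⟨y, hy, z, hz, rfl⟩ := ZFSet.mem_prod.1 (ZFSet.mem_sep.1 hp).1
    obtain ⟨a, rfl⟩ := exists_enumHered_eq hy
    obtain ⟨b, rfl⟩ := exists_enumHered_eq hz
    exact ZFSet.mem_range.2 ⟨(a, b), rfl⟩

/-- Satisfaction in `H(κ⁺)`. -/
abbrev HSat {k : ℕ} (φ : setLang.Formula (ℕ ⊕ Fin k)) (v : ℕ → Hered κ)
    (w : Fin k → Hered κ) : Prop := Sat (memRel (HeredLT (Order.succ κ))) φ v w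

instance : Nonempty (Hered κ) :=
  ⟨⟨∅, ∅, ZFSet.isTransitive_empty, fun _ h => h, by simp⟩⟩

/-- The value of an operation. -/
def Op.eval (hκ : ℵ₀ ≤ κ) : ∀ o : Op κ, (o.arity → Hered κ) → Hered κ
  | .enum a => fun f => enumHered (f ⟨⟩) a
  | .range a => fun f => ⟨ZFSet.range fun i : Set.Iio a => (f i).1,
      heredLT_range hκ (mk_Iio_pt_lt a).le fun i => (f i).2⟩
  | .union => fun f => ⟨ZFSet.sUnion (f ⟨⟩).1, heredLT_union (f ⟨⟩).2⟩
  | .wellOrder => fun f => ⟨wellOrderCode (f ⟨⟩).1, heredLT_wellOrderCode hκ (f ⟨⟩)⟩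
  | .sep φ => fun f => ⟨(f ⟨0⟩).1.sep fun x => ∃ h, HSat φ (fun n => f ⟨n + 1⟩) ![⟨x, h⟩],
      (f ⟨0⟩).2.mono fun _ hx => (ZFSet.mem_sep.1 hx).1⟩
  | .coll φ => fun f => ⟨ZFSet.range fun a : Pt κ =>
        (Classical.epsilon fun y => HSat φ (fun n => f ⟨n + 1⟩) ![enumHered (f ⟨0⟩) a, y] :
          Hered κ).1,
      heredLT_range hκ (mk_pt κ).le fun _ => Subtype.prop _⟩
  | .skolem n φ => fun f => Classical.epsilon fun y : Hered κ =>
      φ.Realize default (Fin.snoc (fun i : Fin n => f ⟨i⟩) y : Fin (n + 1) → Hered κ)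

end Hull

/-! ### The hulls are suitable models. -/

section Suitable

open FirstOrder

variable {κ : Cardinal.{u}}

/-- `κ` as an element of `H(κ⁺)`. -/
def kappaHered (κ : Cardinal.{u}) : Hered κ :=
  ⟨κ.ord.toZFSet, heredLT_ord (by simp)⟩

/-- The members of the hull of `S`. -/
abbrev InHull (hκ : ℵ₀ ≤ κ) (S : Set (Hered κ)) : Hered κ → Prop :=
  GenBy (Op.eval hκ) (insert (kappaHered κ) S)

/-- The hull of `S` as a set. -/
def hull (hκ : ℵ₀ ≤ κ) (S : Set (Hered κ)) : ZFSet.{u} :=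
  Classical.epsilon fun M => ∀ x, x ∈ M ↔ ∃ h, InHull hκ S ⟨x, h⟩

/-- `hull` is chosen by `Classical.epsilon` and has the intended members only if the closure is a
set. The covering by at most `θ` terms shows this and bounds the size at once. -/
theorem hull_spec (hunc : ℵ₀ < κ) {S : Set (Hered κ)} {θ : Cardinal.{u}} (hκθ : κ ≤ θ)
    (hpow : ∀ ν < κ, θ ^ ν ≤ θ) {ι : Type u} (c : ι → Hered κ) (hc : S ⊆ Set.range c)
    (hι : #ι ≤ θ) :
    (∀ x, x ∈ hull hunc.le S ↔ ∃ h, InHull hunc.le S ⟨x, h⟩) ∧ (hull hunc.le S).card ≤ θ := by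
  obtain ⟨T, e, hT, he⟩ := exists_genBy_surjection (Op.eval hunc.le)
    (S := insert (kappaHered κ) S) (fun i : Option ι => i.elim (kappaHered κ) c)
    (by
      rintro x (rfl | hx)
      · exact ⟨none, rfl⟩
      · obtain ⟨i, rfl⟩ := hc hx
        exact ⟨some i, rfl⟩) (hunc.le.trans hκθ)
    (by
      rw [mk_option]
      exact add_le_of_le (hunc.le.trans hκθ) hι (one_le_aleph0.trans (hunc.le.trans hκθ)))
    ((mk_op_le hunc.le).trans hκθ) fun o => hpow _ (o.mk_arity_lt hunc)
  have hex : ∃ M : ZFSet.{u}, ∀ x, x ∈ M ↔ ∃ h, InHull hunc.le S ⟨x, h⟩ := by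
    refine ⟨ZFSet.range fun t : {t : T // InHull hunc.le S (e t)} => (e t.1).1, fun x => ?_⟩
    rw [ZFSet.mem_range]
    constructor
    · rintro ⟨⟨t, ht⟩, rfl⟩
      exact ⟨_, ht⟩
    · rintro ⟨h, hx⟩
      obtain ⟨t, ht⟩ := he _ hx
      exact ⟨⟨t, by rwa [ht]⟩, by simp [ht]⟩
  have hmem : ∀ x, x ∈ hull hunc.le S ↔ ∃ h, InHull hunc.le S ⟨x, h⟩ :=
    Classical.epsilon_spec hex
  refine ⟨hmem, ?_⟩
  refine (ZFSet.card_mono (y := ZFSet.range fun t : T => (e t).1) fun x hx => ?_).trans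
    ((card_range_le _).trans hT)
  obtain ⟨h, hx⟩ := (hmem x).1 hx
  obtain ⟨t, ht⟩ := he _ hx
  exact ZFSet.mem_range.2 ⟨t, by simp [ht]⟩

theorem isUPair_memRel {M : ZFSet.{u}} (hM : M.IsTransitive) (z x y : {x // x ∈ M}) :
    IsUPair (memRel (· ∈ M)) z x y ↔ z.1 = {x.1, y.1} := by
  constructor
  · intro h
    ext w
    rw [ZFSet.mem_pair]
    constructor
    · intro hw
      simpa [Subtype.ext_iff] using (h ⟨w, hM _ z.2 hw⟩).1 hw
    · rintro (rfl | rfl)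
      · exact (h x).2 (.inl rfl)
      · exact (h y).2 (.inr rfl)
  · intro h w
    rw [memRel, h, ZFSet.mem_pair, Subtype.ext_iff, Subtype.ext_iff]

theorem isOPair_memRel {M : ZFSet.{u}} (hM : M.IsTransitive)
    (hp : ∀ x ∈ M, ∀ y ∈ M, ({x, y} : ZFSet.{u}) ∈ M) (p x y : {x // x ∈ M}) :
    IsOPair (memRel (· ∈ M)) p x y ↔ p.1 = ZFSet.pair x.1 y.1 := by
  simp only [IsOPair, isUPair_memRel hM]
  constructor
  · intro h
    ext w
    rw [ZFSet.pair, ZFSet.mem_pair]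
    constructor
    · intro hw
      simpa using (h ⟨w, hM _ p.2 hw⟩).1 hw
    · rintro (rfl | rfl)
      · have hx := hp _ x.2 _ x.2
        exact (h ⟨_, by simpa using hx⟩).2 (.inl (by simp))
      · exact (h ⟨_, hp _ x.2 _ y.2⟩).2 (.inr rfl)
  · intro h w
    simp [memRel, h, ZFSet.pair]

theorem inRel_memRel {M : ZFSet.{u}} (hM : M.IsTransitive)
    (hp : ∀ x ∈ M, ∀ y ∈ M, ({x, y} : ZFSet.{u}) ∈ M) (r x y : {x // x ∈ M}) :
    InRel (memRel (· ∈ M)) r x y ↔ ZFSet.pair x.1 y.1 ∈ r.1 := by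
  simp only [InRel, isOPair_memRel hM hp]
  constructor
  · rintro ⟨p, hp, h⟩
    rwa [← h]
  · exact fun h => ⟨⟨_, hM _ r.2 h⟩, h, rfl⟩

theorem wellOrders_memRel {M : ZFSet.{u}} (hM : M.IsTransitive)
    (hp : ∀ x ∈ M, ∀ y ∈ M, ({x, y} : ZFSet.{u}) ∈ M) (r a : {x // x ∈ M})
    (hr : r.1 = wellOrderCode a.1) : WellOrders (memRel (· ∈ M)) r a := by
  have key : ∀ x y : {x // x ∈ M}, x.1 ∈ a.1 → y.1 ∈ a.1 →
      (InRel (memRel (· ∈ M)) r x y ↔ WellOrderingRel x.1 y.1) := fun x y hx hy => by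
    rw [inRel_memRel hM hp, hr, pair_mem_wellOrderCode hx hy]
  refine ⟨fun x hx => ?_, fun x y z hx hy hz => ?_, fun x y hx hy => ?_, fun b hb hba => ?_⟩
  · rw [key x x hx hx]
    exact irrefl _
  · rw [key x y hx hy, key y z hy hz, key x z hx hz]
    exact _root_.trans
  · rw [key x y hx hy, key y x hy hx, Subtype.ext_iff]
    exact trichotomous_of WellOrderingRel x.1 y.1
  · have wf : WellFounded (WellOrderingRel : ZFSet.{u} → ZFSet.{u} → Prop) := IsWellFounded.wf
    obtain ⟨x, hx⟩ := hb
    have hne : {z : ZFSet.{u} | z ∈ b.1}.Nonempty := ⟨x.1, hx⟩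
    have hm : wf.min _ hne ∈ b.1 := wf.min_mem _ hne
    refine ⟨⟨_, hM _ b.2 hm⟩, hm, fun y hy => ?_⟩
    rw [key y ⟨_, hM _ b.2 hm⟩ (hba y hy) (hba ⟨_, hM _ b.2 hm⟩ hm)]
    exact wf.not_lt_min _ hy

/-- Each clause has its operation: `enum` gives transitivity, `range` gives pairs and closure under
short sequences, `union` and `wellOrder` their axioms. The operations `sep` and `coll` refer to
satisfaction in `H(κ⁺)`, which `skolem` makes equivalent to satisfaction in `M`. -/
theorem isSuitable_of_forall_mem_iff (hreg : κ.IsRegular) (hunc : ℵ₀ < κ) {S : Set (Hered κ)}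
    {M : ZFSet.{u}} (hmem : ∀ x, x ∈ M ↔ ∃ h, InHull hunc.le S ⟨x, h⟩) : IsSuitable κ M := by
  have hered : ∀ x ∈ M, HeredLT (Order.succ κ) x := fun x hx => ((hmem x).1 hx).1
  have hop : ∀ (o : Op κ) (f : o.arity → Hered κ), (∀ b, (f b).1 ∈ M) →
      (o.eval hunc.le f).1 ∈ M := fun o f hf =>
    (hmem _).2 ⟨_, .app o f fun b => ((hmem _).1 (hf b)).2⟩
  have hκM : κ.ord.toZFSet ∈ M := (hmem _).2 ⟨_, .base _ (.inl rfl)⟩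
  have htr : M.IsTransitive := fun x hx y hy => by
    obtain ⟨a, ha⟩ := exists_enumHered_eq (x := ⟨x, hered x hx⟩) hy
    rw [← ha]
    exact hop (.enum a) (fun _ => ⟨x, hered x hx⟩) fun _ => hx
  have hrange : ∀ (a : Pt κ) (g : Set.Iio a → ZFSet.{u}), (∀ i, g i ∈ M) →
      ZFSet.range g ∈ M := fun a g hg =>
    hop (.range a) (fun i => ⟨g i, hered _ (hg i)⟩) hg
  have hpair : ∀ x ∈ M, ∀ y ∈ M, ({x, y} : ZFSet.{u}) ∈ M := fun x hx y hy => by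
    classical
    -- A pair is the range of a sequence of length `a`; two distinct points below `a` ensure that
    -- both values are taken.
    obtain ⟨b⟩ := pt_nonempty hreg
    obtain ⟨c, hc⟩ := exists_pt_gt hreg b
    obtain ⟨a, ha⟩ := exists_pt_gt hreg c
    have := hrange a (fun i => if i.1 = b then x else y) fun i => by
      split <;> assumption
    convert this using 1
    ext z
    rw [ZFSet.mem_pair, ZFSet.mem_range]
    constructor
    · rintro (rfl | rfl)
      · exact ⟨⟨b, hc.trans ha⟩, by simp⟩
      · exact ⟨⟨c, ha⟩, by simp [hc.ne']⟩
    · rintro ⟨i, rfl⟩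
      split <;> simp
  have hop2 : ∀ x ∈ M, ∀ y ∈ M, ZFSet.pair x y ∈ M := fun x hx y hy =>
    hpair _ (by simpa using hpair x hx x hx) _ (hpair x hx y hy)
  have hsat := fun {k : ℕ} => sat_iff_sat_hered hered
    (fun n φ x hx a ha => by
      have hne : Nonempty (Hered κ) := inferInstance
      refine ⟨Classical.epsilon fun y : Hered κ => φ.Realize default (Fin.snoc x y), ?_,
        Classical.epsilon_spec (p := fun y : Hered κ => φ.Realize default (Fin.snoc x y)) ⟨a, ha⟩⟩
      -- The operation takes `ℕ` many arguments but reads only the first `n`; the rest are filled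
      -- with `κ`.
      have := hop (.skolem n φ)
        (fun i => if h : i.down < n then x ⟨i.down, h⟩ else kappaHered κ) fun i => by
          split
          · exact hx _
          · exact hκM
      simpa [Op.eval] using this) (k := k)
  have hvec1 : ∀ x : {x // x ∈ M}, (fun i => (⟨(![x] i).1, hered _ (![x] i).2⟩ : Hered κ)) =
      ![⟨x.1, hered _ x.2⟩] := fun x => by
    funext i
    fin_cases i
    rfl
  have hvec2 : ∀ x y : {x // x ∈ M},
      (fun i => (⟨(![x, y] i).1, hered _ (![x, y] i).2⟩ : Hered κ)) =
      ![⟨x.1, hered _ x.2⟩, ⟨y.1, hered _ y.2⟩] := fun x y => by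
    funext i
    fin_cases i <;> rfl
  refine ⟨htr, hered, hκM, ⟨?_, ?_, ?_, ?_, ?_, ?_, ?_, ?_⟩, ?_⟩
  · intro a b h
    refine Subtype.ext (ZFSet.ext fun x => ⟨fun hx => ?_, fun hx => ?_⟩)
    · exact (h ⟨x, htr _ a.2 hx⟩).1 hx
    · exact (h ⟨x, htr _ b.2 hx⟩).2 hx
  · rintro a ⟨x, hx⟩
    obtain ⟨y, hy, hay⟩ := ZFSet.regularity a.1 (fun h => by
      have hx' : x.1 ∈ a.1 := hx
      rw [h] at hx'
      exact ZFSet.notMem_empty _ hx')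
    refine ⟨⟨y, htr _ a.2 hy⟩, hy, fun z hz hza => ?_⟩
    have : z.1 ∈ a.1 ∩ y := ZFSet.mem_inter.2 ⟨hza, hz⟩
    rw [hay] at this
    exact ZFSet.notMem_empty _ this
  · exact fun a b => ⟨⟨_, hpair _ a.2 _ b.2⟩, (isUPair_memRel htr _ _ _).2 rfl⟩
  · intro a
    refine ⟨⟨ZFSet.sUnion a.1, hop .union (fun _ => ⟨a.1, hered _ a.2⟩) fun _ => a.2⟩, fun x => ?_⟩
    change x.1 ∈ ZFSet.sUnion a.1 ↔ _
    rw [ZFSet.mem_sUnion]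
    constructor
    · rintro ⟨z, hz, hxz⟩
      exact ⟨⟨z, htr _ a.2 hz⟩, hz, hxz⟩
    · rintro ⟨z, hz, hxz⟩
      exact ⟨z.1, hz, hxz⟩
  · have hlim : Order.IsSuccLimit κ.ord := isSuccLimit_ord hreg.aleph0_le
    have h0 : (∅ : ZFSet.{u}) ∈ κ.ord.toZFSet :=
      Ordinal.mem_toZFSet_iff.2 ⟨0, hreg.ord_pos, by simp⟩
    refine ⟨⟨_, hκM⟩, ⟨⟨∅, htr _ hκM h0⟩, h0, fun x => ZFSet.notMem_empty _⟩, ?_⟩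
    rintro ⟨x, hx'⟩ (hx : x ∈ κ.ord.toZFSet)
    obtain ⟨o, ho, rfl⟩ := Ordinal.mem_toZFSet_iff.1 hx
    have hs : (o + 1).toZFSet ∈ κ.ord.toZFSet :=
      Ordinal.mem_toZFSet_iff.2 ⟨o + 1, hlim.add_one_lt ho, rfl⟩
    refine ⟨⟨_, htr _ hκM hs⟩, hs, fun z => ?_⟩
    simp only [Ordinal.toZFSet_add_one, ZFSet.mem_insert_iff, Subtype.ext_iff]
    exact or_comm
  · intro φ v a
    -- Argument `0` is the set to be separated, argument `n + 1` is the parameter `v n`.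
    have h := hop (.sep φ) (fun i => Nat.casesOn i.down ⟨a.1, hered _ a.2⟩
      fun n => ⟨(v n).1, hered _ (v n).2⟩) (by rintro ⟨_ | n⟩; exacts [a.2, (v n).2])
    refine ⟨⟨_, h⟩, fun x => ?_⟩
    rw [hsat, hvec1]
    change x.1 ∈ ZFSet.sep (fun y => ∃ h, HSat φ (fun n => ⟨(v n).1, hered _ (v n).2⟩)
      ![⟨y, h⟩]) a.1 ↔ _
    rw [ZFSet.mem_sep]
    refine and_congr Iff.rfl ?_
    exact ⟨fun ⟨_, h⟩ => h, fun h => ⟨_, h⟩⟩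
  · intro φ v a ha
    have h := hop (.coll φ) (fun i => Nat.casesOn i.down ⟨a.1, hered _ a.2⟩
      fun n => ⟨(v n).1, hered _ (v n).2⟩) (by rintro ⟨_ | n⟩; exacts [a.2, (v n).2])
    refine ⟨⟨_, h⟩, fun x hx => ?_⟩
    obtain ⟨y, hy⟩ := ha x hx
    rw [hsat, hvec2] at hy
    obtain ⟨c, hc⟩ := exists_enumHered_eq (x := ⟨a.1, hered _ a.2⟩) hx
    have hxc : (⟨x.1, hered _ x.2⟩ : Hered κ) = enumHered ⟨a.1, hered _ a.2⟩ c :=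
      Subtype.ext hc.symm
    rw [hxc] at hy
    have hsp := Classical.epsilon_spec (p := fun y : Hered κ =>
      HSat φ (fun n => ⟨(v n).1, hered _ (v n).2⟩) ![enumHered ⟨a.1, hered _ a.2⟩ c, y]) ⟨_, hy⟩
    have hm := ZFSet.mem_range_self (f := fun c : Pt κ => (Classical.epsilon fun y : Hered κ =>
      HSat φ (fun n => ⟨(v n).1, hered _ (v n).2⟩) ![enumHered ⟨a.1, hered _ a.2⟩ c, y]).1) c
    refine ⟨⟨_, htr _ h hm⟩, hm, ?_⟩
    rw [hsat, hvec2, hxc]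
    exact hsp
  · intro a
    exact ⟨⟨_, hop .wellOrder (fun _ => ⟨a.1, hered _ a.2⟩) fun _ => a.2⟩,
      wellOrders_memRel htr hpair _ _ rfl⟩
  · intro η hη f hf
    -- The points below `a` correspond to the ordinals below `η`, so the graph of `f` is the range
    -- of a sequence of pairs indexed by `Set.Iio a`.
    let a : Pt κ := Ordinal.ToType.mk ⟨η, hη⟩
    have hlt : ∀ i : Set.Iio a, (i.1.toOrd : Ordinal.{u}) < η := fun i => by
      have h : i.1.toOrd < ⟨η, hη⟩ := by simpa [a] using Ordinal.ToType.mk.symm.lt_iff_lt.2 i.2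
      exact h
    choose w hw _ using fun i : Set.Iio a => hf.2 _ (Ordinal.toZFSet_mem_toZFSet_iff.2 (hlt i))
    have hwM : ∀ i, w i ∈ M := fun i => (ZFSet.pair_mem_prod.1 (hf.1 (hw i))).2
    have hords : ∀ i : Set.Iio a, (i.1.toOrd : Ordinal.{u}).toZFSet ∈ M := fun i =>
      htr _ hκM (Ordinal.toZFSet_mem_toZFSet_iff.2 ((hlt i).trans hη))
    convert hrange a (fun i => ZFSet.pair (i.1.toOrd : Ordinal.{u}).toZFSet (w i))
      fun i => hop2 _ (hords i) _ (hwM i) using 1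
    ext p
    rw [ZFSet.mem_range]
    constructor
    · intro hp
      obtain ⟨x, hx, y, hy, rfl⟩ := ZFSet.mem_prod.1 (hf.1 hp)
      obtain ⟨o, ho, rfl⟩ := Ordinal.mem_toZFSet_iff.1 hx
      have hoa : Ordinal.ToType.mk ⟨o, ho.trans hη⟩ < a :=
        Ordinal.ToType.mk.lt_iff_lt.2 (show (⟨o, ho.trans hη⟩ : Set.Iio κ.ord) < ⟨η, hη⟩ from ho)
      refine ⟨⟨Ordinal.ToType.mk ⟨o, ho.trans hη⟩, hoa⟩, ?_⟩
      have h1 := hw ⟨Ordinal.ToType.mk ⟨o, ho.trans hη⟩, hoa⟩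
      simp only [OrderIso.symm_apply_apply] at h1 ⊢
      rw [(hf.2 _ hx).unique h1 hp]
    · rintro ⟨i, rfl⟩
      exact hw i

end Suitable

/-! ### Subsets of `κ` in suitable models -/

section Codes

open FirstOrder

variable {κ : Cardinal.{u}}

theorem ptCode_mem_ptCode {a b : Pt κ} : ptCode a ∈ ptCode b ↔ a < b := by
  rw [ptCode, ptCode, Ordinal.toZFSet_mem_toZFSet_iff]
  exact Ordinal.ToType.mk.symm.lt_iff_lt

theorem ptCode_injective : Function.Injective (ptCode : Pt κ → ZFSet.{u}) := fun a b h => by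
  rcases lt_trichotomy a b with hab | hab | hab
  · rw [← ptCode_mem_ptCode, h] at hab
    exact absurd hab (ZFSet.mem_irrefl _)
  · exact hab
  · rw [← ptCode_mem_ptCode, h] at hab
    exact absurd hab (ZFSet.mem_irrefl _)

theorem mem_setCode {A : Set (Pt κ)} {x : ZFSet.{u}} :
    x ∈ setCode A ↔ ∃ a ∈ A, ptCode a = x := by
  simp [setCode]

theorem ptCode_mem_setCode {A : Set (Pt κ)} {a : Pt κ} : ptCode a ∈ setCode A ↔ a ∈ A := by
  rw [mem_setCode]
  exact ⟨fun ⟨b, hb, h⟩ => ptCode_injective h ▸ hb, fun h => ⟨a, h, rfl⟩⟩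

theorem setCode_injective : Function.Injective (setCode : Set (Pt κ) → ZFSet.{u}) :=
  fun A B h => Set.ext fun a => by rw [← ptCode_mem_setCode, h, ptCode_mem_setCode]

theorem mem_kappa_iff {x : ZFSet.{u}} : x ∈ κ.ord.toZFSet ↔ ∃ a : Pt κ, ptCode a = x := by
  rw [Ordinal.mem_toZFSet_iff]
  constructor
  · rintro ⟨o, ho, rfl⟩
    exact ⟨Ordinal.ToType.mk ⟨o, ho⟩, by simp [ptCode]⟩
  · rintro ⟨a, rfl⟩
    exact ⟨_, a.toOrd.2, rfl⟩

theorem setCode_univ : setCode (Set.univ : Set (Pt κ)) = κ.ord.toZFSet := by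
  ext x
  rw [mem_setCode, mem_kappa_iff]
  simp

theorem heredLT_setCode (hκ : ℵ₀ ≤ κ) (A : Set (Pt κ)) : HeredLT (Order.succ κ) (setCode A) :=
  heredLT_range hκ ((mk_set_le A).trans (mk_pt κ).le) fun a =>
    heredLT_ord ((Cardinal.lt_ord.1 a.1.toOrd.2).trans (Order.lt_succ κ))

theorem mem_ptCode {a : Pt κ} {x : ZFSet.{u}} : x ∈ ptCode a ↔ ∃ b < a, ptCode b = x := by
  constructor
  · intro h
    obtain ⟨o, ho, rfl⟩ := Ordinal.mem_toZFSet_iff.1 h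
    refine ⟨Ordinal.ToType.mk ⟨o, ho.trans a.toOrd.2⟩, ?_, by simp [ptCode]⟩
    rw [← ptCode_mem_ptCode]
    simpa [ptCode] using ho
  · rintro ⟨b, hb, rfl⟩
    exact ptCode_mem_ptCode.2 hb

/-- The formula `s ∈ t`. -/
def memFormula {α : Type} {n : ℕ} (s t : α ⊕ Fin n) : setLang.BoundedFormula α n :=
  Language.Relations.boundedFormula₂ (L := setLang) SetRel.mem (.var s) (.var t)

theorem realize_memFormula {N : Type*} (E : N → N → Prop) {α : Type} {n : ℕ} (s t : α ⊕ Fin n)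
    (v : α → N) (xs : Fin n → N) :
    letI := setStructure E
    (memFormula s t).Realize v xs ↔ E (Sum.elim v xs s) (Sum.elim v xs t) :=
  Iff.rfl

/-- The formula `s = t`. -/
abbrev eqFormula {α : Type} {n : ℕ} (s t : α ⊕ Fin n) : setLang.BoundedFormula α n :=
  (Language.Term.bdEqual (.var s) (.var t) : setLang.BoundedFormula α n)

theorem IsSuitable.sep_mem {M : ZFSet.{u}} (hM : IsSuitable κ M)
    (φ : setLang.Formula (ℕ ⊕ Fin 1)) (v : ℕ → {x // x ∈ M}) {a : ZFSet.{u}} (ha : a ∈ M)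
    {P : ZFSet.{u} → Prop}
    (h : ∀ x : {x // x ∈ M}, x.1 ∈ a → (Sat (memRel (· ∈ M)) φ v ![x] ↔ P x.1)) :
    ZFSet.sep P a ∈ M := by
  obtain ⟨b, hb⟩ := hM.models.separation φ v ⟨a, ha⟩
  convert b.2
  ext x
  rw [ZFSet.mem_sep]
  constructor
  · rintro ⟨hx, hP⟩
    exact (hb ⟨x, hM.transitive _ ha hx⟩).2 ⟨hx, (h _ hx).2 hP⟩
  · intro hx
    obtain ⟨hx1, hx2⟩ := (hb ⟨x, hM.transitive _ b.2 hx⟩).1 hx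
    exact ⟨hx1, (h _ hx1).1 hx2⟩

theorem IsSuitable.compl_mem {M : ZFSet.{u}} (hM : IsSuitable κ M) {A : Set (Pt κ)}
    (hA : setCode A ∈ M) : setCode Aᶜ ∈ M := by
  have := hM.sep_mem (memFormula (.inl (.inr 0)) (.inl (.inl 0))).not (fun _ => ⟨_, hA⟩)
    hM.kappa_mem (P := fun x => x ∉ setCode A) (fun x _ => by
      simp [Sat, Language.Formula.Realize, realize_memFormula, memRel])
  convert this
  ext x
  rw [ZFSet.mem_sep, mem_setCode, mem_kappa_iff]
  constructor
  · rintro ⟨a, ha, rfl⟩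
    exact ⟨⟨a, rfl⟩, fun h => ha (ptCode_mem_setCode.1 h)⟩
  · rintro ⟨⟨a, rfl⟩, h⟩
    exact ⟨a, fun h' => h (ptCode_mem_setCode.2 h'), rfl⟩

theorem IsSuitable.inter_mem {M : ZFSet.{u}} (hM : IsSuitable κ M) {A B : Set (Pt κ)}
    (hA : setCode A ∈ M) (hB : setCode B ∈ M) : setCode (A ∩ B) ∈ M := by
  have := hM.sep_mem (memFormula (.inl (.inr 0)) (.inl (.inl 0))) (fun _ => ⟨_, hB⟩)
    hA (P := fun x => x ∈ setCode B) (fun x _ => by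
      simp [Sat, Language.Formula.Realize, realize_memFormula, memRel])
  convert this
  ext x
  rw [ZFSet.mem_sep, mem_setCode, mem_setCode]
  constructor
  · rintro ⟨a, ha, rfl⟩
    exact ⟨⟨a, ha.1, rfl⟩, ptCode_mem_setCode.2 ha.2⟩
  · rintro ⟨⟨a, ha, rfl⟩, h⟩
    exact ⟨a, ⟨ha, ptCode_mem_setCode.1 h⟩, rfl⟩

/-- A formula that defines the diagonal intersection of a sequence of subsets of `κ`. -/
def diagFormula : setLang.Formula (ℕ ⊕ Fin 1) :=
  .all (.imp (memFormula (.inr 0) (.inl (.inr 0)))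
    (.ex (memFormula (.inr 1) (.inl (.inl 0)) ⊓
      (.ex (memFormula (.inr 2) (.inr 1) ⊓
        .all ((memFormula (.inr 3) (.inr 2)).iff (eqFormula (.inr 3) (.inr 0)))) ⊓
      .ex (memFormula (.inr 2) (.inr 1) ⊓
        .ex (memFormula (.inr 3) (.inr 2) ⊓ memFormula (.inl (.inr 0)) (.inr 3)))))))

/-- The formula does not pin down ordered pairs: it asks only that `p` contain `{α}` and that `x`
belong to a member of a member of `p`. For `p = (α, A_α)` and `α ∈ x ∈ κ` this is enough. -/
theorem sat_diagFormula {N : Type*} (E : N → N → Prop) (v : ℕ → N) (x : N) :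
    Sat E diagFormula v ![x] ↔ ∀ α, E α x → ∃ p, E p (v 0) ∧
      (∃ r, E r p ∧ ∀ z, E z r ↔ z = α) ∧ ∃ q, E q p ∧ ∃ A, E A q ∧ E x A := by
  simp [Sat, diagFormula, Language.Formula.Realize, realize_memFormula, Fin.snoc]

theorem IsSuitable.diagInter_mem {M : ZFSet.{u}} (hM : IsSuitable κ M)
    {A : Pt κ → Set (Pt κ)} (hA : seqCode A ∈ M) : setCode (diagInter A) ∈ M := by
  have := hM.sep_mem diagFormula (fun _ => ⟨_, hA⟩) hM.kappa_mem
    (P := fun x => x ∈ setCode (diagInter A)) (fun x hx => by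
      obtain ⟨b, hb⟩ := mem_kappa_iff.1 hx
      rw [sat_diagFormula, ← hb, ptCode_mem_setCode]
      have hκM : ∀ a : Pt κ, ptCode a ∈ M := fun a =>
        hM.transitive _ hM.kappa_mem (mem_kappa_iff.2 ⟨a, rfl⟩)
      constructor
      · intro h a hab
        obtain ⟨p, hp, ⟨r, hr, hrz⟩, q, hq, B, hB, hxB⟩ := h ⟨ptCode a, hκM a⟩
          (by rw [memRel, ← hb]; exact ptCode_mem_ptCode.2 hab)
        obtain ⟨c, hc⟩ := ZFSet.mem_range.1 (show p.1 ∈ seqCode A from hp)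
        have hra : r.1 = {ptCode a} := by
          ext z
          rw [ZFSet.mem_singleton]
          constructor
          · intro hz
            exact congrArg Subtype.val ((hrz ⟨z, hM.transitive _ r.2 hz⟩).1 hz)
          · rintro rfl
            exact (hrz ⟨_, hκM a⟩).2 rfl
        have hr' : r.1 ∈ ZFSet.pair (ptCode c) (setCode (A c)) := hc ▸ hr
        have hca : c = a := by
          have : ptCode c ∈ r.1 := by
            rcases ZFSet.mem_pair.1 hr' with h | h <;> simp [h]
          rw [hra, ZFSet.mem_singleton] at this
          exact ptCode_injective this
        subst hca
        have hq' : q.1 ∈ ZFSet.pair (ptCode c) (setCode (A c)) := hc ▸ hq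
        have hBq : B.1 ∈ q.1 := hB
        have hxB' : ptCode b ∈ B.1 := hb ▸ hxB
        have hBor : B.1 = ptCode c ∨ B.1 = setCode (A c) := by
          rcases ZFSet.mem_pair.1 hq' with h | h <;> rw [h] at hBq <;> simp at hBq
          · exact .inl hBq
          · exact hBq
        -- The first coordinate cannot be the set containing `b`, as it is an ordinal below `b`.
        rcases hBor with h | h
        · rw [h, ptCode_mem_ptCode] at hxB'
          exact absurd hab hxB'.not_gt
        · rwa [h, ptCode_mem_setCode] at hxB'
      · rintro h ⟨y, hy⟩ hyx
        have hyx' : y ∈ ptCode b := by rw [hb]; exact hyx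
        obtain ⟨a, hab, rfl⟩ := mem_ptCode.1 hyx'
        have hp : ZFSet.pair (ptCode a) (setCode (A a)) ∈ seqCode A :=
          ZFSet.mem_range.2 ⟨a, rfl⟩
        have hpM := hM.transitive _ hA hp
        have h1 : ({ptCode a} : ZFSet.{u}) ∈ ZFSet.pair (ptCode a) (setCode (A a)) := by
          simp [ZFSet.pair]
        have h2 : ({ptCode a, setCode (A a)} : ZFSet.{u}) ∈
            ZFSet.pair (ptCode a) (setCode (A a)) := by
          simp [ZFSet.pair]
        have h3 : setCode (A a) ∈ ({ptCode a, setCode (A a)} : ZFSet.{u}) := by simp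
        have h2M := hM.transitive _ hpM h2
        refine ⟨⟨_, hpM⟩, hp, ⟨⟨_, hM.transitive _ hpM h1⟩, h1, fun z => ?_⟩, ⟨_, h2M⟩, h2,
          ⟨_, hM.transitive _ h2M h3⟩, h3, ?_⟩
        · simp [memRel, Subtype.ext_iff]
        · change x.1 ∈ setCode (A a)
          rw [← hb, ptCode_mem_setCode]
          exact h a hab)
  convert this
  ext x
  rw [ZFSet.mem_sep]
  refine ⟨fun hx => ⟨?_, hx⟩, fun h => h.2⟩
  obtain ⟨a, _, rfl⟩ := mem_setCode.1 hx
  exact mem_kappa_iff.2 ⟨a, rfl⟩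

end Codes

/-! ### From `P`-points to winning strategies -/

section PPoint

variable {κ μ : Cardinal.{u}}

theorem mem_of_almostSubset {U : Ultrafilter (Pt κ)} (hU : IsUniform (U : Filter (Pt κ)))
    {A B : Set (Pt κ)} (hB : B ∈ U) (h : AlmostSubset B A) : A ∈ U := by
  obtain ⟨a, ha⟩ := h
  exact Filter.mem_of_superset (Filter.inter_mem hB (hU.Ici_mem a)) fun x hx => ha x hx.1 hx.2

theorem IsPPoint.cardinalInterFilter (hreg : κ.IsRegular) (hκμ : κ ≤ μ) {U : Ultrafilter (Pt κ)}
    (hU : IsPPoint μ (U : Filter (Pt κ))) : CardinalInterFilter (U : Filter (Pt κ)) κ := by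
  refine ⟨fun S hS hSU => ?_⟩
  obtain ⟨B, hB, hBA⟩ := hU.2 S hSU (hS.trans_le hκμ)
  exact mem_of_almostSubset hU.1 hB (almostSubset_sInter hreg hS hBA)

/-- An ultrafilter decides everything, so all functions and all sequences are admitted in the
minimality argument. Pseudo-intersections for the image ultrafilter are images of
pseudo-intersections of preimages. -/
theorem exists_normal_pPoint (hreg : κ.IsRegular) (hunc : ℵ₀ < κ) (hκμ : κ ≤ μ)
    (h : CarriesPPoint κ μ) : ∃ V : Ultrafilter (Pt κ), IsPPoint μ (V : Filter (Pt κ)) ∧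
      ∀ A : Pt κ → Set (Pt κ), (∀ a, A a ∈ V) → diagInter A ∈ V := by
  obtain ⟨U, hU⟩ := h
  have := hU.cardinalInterFilter hreg hκμ
  obtain ⟨h, -, hgt, hdiag⟩ := exists_minimal_preimage_diagInter_mem hreg hunc
    (F := (U : Filter (Pt κ))) Set.univ Set.univ trivial hU.1.Ici_mem (fun _ _ _ _ => trivial)
    (fun _ _ _ => U.mem_or_compl_mem _) (fun _ _ _ _ => U.mem_or_compl_mem _)
  refine ⟨U.map h, ⟨fun A hA => mk_eq_of_unbounded hreg fun a => ?_, fun 𝒜 h𝒜 hcard => ?_⟩,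
    fun A hA => hdiag A trivial hA⟩
  · obtain ⟨x, hx1, hx2⟩ := Filter.nonempty_of_mem (Filter.inter_mem (f := (U : Filter (Pt κ))) (s := h ⁻¹' A) hA (hgt a))
    exact ⟨h x, hx1, le_of_lt hx2⟩
  · obtain ⟨B, hB, hBA⟩ := hU.2 (Set.preimage h '' 𝒜)
      (by rintro _ ⟨A, hA, rfl⟩; exact h𝒜 A hA) (mk_image_le.trans_lt hcard)
    exact ⟨h '' B, Filter.mem_of_superset (f := (U : Filter (Pt κ))) (y := h ⁻¹' (h '' B)) hB
      (Set.subset_preimage_image h B),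
      fun A hA => (hBA _ ⟨A, hA, rfl⟩).image hreg⟩

theorem mk_powerIn_le (M : ZFSet.{u}) : #(powerIn κ M) ≤ M.card :=
  mk_le_of_injective (f := fun A : powerIn κ M => equivShrink M ⟨setCode A.1, A.2⟩)
    fun _ _ h => Subtype.ext (setCode_injective
      (congrArg Subtype.val ((equivShrink M).injective h)))

/-- A `⊆*`-decreasing sequence of members of `U`, the `i`-th of which is almost included in all
members of `U` that belong to `M i`. -/
def tower (U : Ultrafilter (Pt κ)) (M : Ordinal.{u} → ZFSet.{u}) (i : Ordinal.{u}) :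
    Set (Pt κ) :=
  Classical.epsilon fun B => B ∈ U ∧ (∀ A ∈ U, setCode A ∈ M i → AlmostSubset B A) ∧
    ∀ j : Set.Iio i, AlmostSubset B (tower U M j)
termination_by i
decreasing_by exact j.2

/-- A strategy sees only the moves up to stage `i`; the tower may thus be computed from any
extension of them to all ordinals. -/
theorem tower_congr (U : Ultrafilter (Pt κ)) {M M' : Ordinal.{u} → ZFSet.{u}} (i : Ordinal.{u})
    (h : ∀ j ≤ i, M j = M' j) : tower U M i = tower U M' i := by
  induction i using WellFoundedLT.induction with
  | ind i ih =>
    rw [tower, tower]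
    have h' : ∀ j : Set.Iio i, tower U M j = tower U M' j := fun j =>
      ih j j.2 fun l hl => h l (hl.trans j.2.le)
    simp only [h', h i le_rfl]

/-- The size bound on `M i` and `i < μ.ord` leave fewer than `μ` sets to be almost included in, so
the `P_μ`-property supplies the next set. -/
theorem tower_spec {U : Ultrafilter (Pt κ)} (hU : IsPPoint μ (U : Filter (Pt κ))) (hκμ : κ < μ)
    (hμ : ℵ₀ ≤ μ) {M : Ordinal.{u} → ZFSet.{u}} (i : Ordinal.{u}) (hi : i < μ.ord)
    (hM : ∀ j ≤ i, LegalI κ M j) : tower U M i ∈ U ∧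
      (∀ A ∈ U, setCode A ∈ M i → AlmostSubset (tower U M i) A) ∧
      ∀ j : Set.Iio i, AlmostSubset (tower U M i) (tower U M j) := by
  induction i using WellFoundedLT.induction with
  | ind i ih =>
    let 𝒜 : Set (Set (Pt κ)) := {A | A ∈ U ∧ A ∈ powerIn κ (M i)} ∪
      Set.range fun j : i.ToType => tower U M j.toOrd
    have hcard : i.card < μ := Cardinal.lt_ord.1 hi
    have h𝒜 : #𝒜 < μ := by
      refine (mk_union_le _ _).trans_lt (add_lt_of_lt hμ ?_ ?_)
      · exact ((mk_le_mk_of_subset fun A hA => hA.2).trans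
          ((mk_powerIn_le (M i)).trans (hM i le_rfl).2.1)).trans_lt (max_lt hκμ hcard)
      · exact mk_range_le.trans_lt (by simpa using hcard)
    obtain ⟨B, hB, hBA⟩ := hU.2 𝒜 (by
      rintro A (hA | ⟨j, rfl⟩)
      · exact hA.1
      · have hj : (j.toOrd : Ordinal.{u}) < i := j.toOrd.2
        exact (ih _ hj (hj.trans hi) fun l hl => hM l (hl.trans hj.le)).1) h𝒜
    rw [tower]
    refine Classical.epsilon_spec (p := fun B => B ∈ U ∧
      (∀ A ∈ U, setCode A ∈ M i → AlmostSubset B A) ∧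
        ∀ j : Set.Iio i, AlmostSubset B (tower U M j))
      ⟨B, hB, fun A hA hAM => hBA A (.inl ⟨hA, hAM⟩), fun j => hBA _ (.inr ⟨?_, ?_⟩)⟩
    · exact Ordinal.ToType.mk j
    · simp

open Classical in
theorem iIWins_of_pPoint (hreg : κ.IsRegular) (hunc : ℵ₀ < κ) (hκμ : κ < μ)
    (h : CarriesPPoint κ μ) : IIWins κ (NSetC κ) μ.ord := by
  obtain ⟨U, hU, hdiag⟩ := exists_normal_pPoint hreg hunc hκμ.le h
  refine ⟨fun i m => genFilter hreg
    (tower U (fun j => if h : j ≤ i then m ⟨j, h⟩ else ∅) i), fun M i hi hM => ?_⟩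
  have hplay : ∀ i, StrategyII.play (fun i m => genFilter hreg
      (tower U (fun j => if h : j ≤ i then m ⟨j, h⟩ else ∅) i)) M i =
      genFilter hreg (tower U M i) := fun i => by
    exact congrArg (genFilter hreg) (tower_congr U i fun j hj => dif_pos hj)
  obtain ⟨hB, hBA, hBj⟩ := tower_spec hU hκμ (hunc.le.trans hκμ.le) i hi hM
  have hS : IsSuitable κ (M i) := (hM i le_rfl).1
  -- On `M i` the generated filter agrees with `U`; every requirement on the restriction is
  -- inherited from `U`.
  have hrestr : ∀ A, A ∈ restrict (genFilter hreg (tower U M i)) (M i) ↔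
      A ∈ U ∧ setCode A ∈ M i := fun A =>
    and_congr_left fun hAM => ⟨fun h => mem_of_almostSubset hU.1 hB h, fun h => hBA A h hAM⟩
  refine ⟨?_, fun j hj A hA => ?_⟩
  · rw [hplay]
    refine ⟨cardinalInterFilter_genFilter hreg _, isUniform_genFilter hreg (hU.1 _ hB),
      ⟨fun A hA => hA.2, ?_, ?_, ?_, ?_, ?_⟩, ?_, ⟨_, fun A => Iff.rfl⟩⟩
    · rw [hrestr, setCode_univ]
      exact ⟨Filter.univ_mem, hS.kappa_mem⟩
    · rw [hrestr]
      exact fun h => U.empty_notMem h.1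
    · intro A hA A' hA'
      rw [hrestr] at *
      exact ⟨Filter.inter_mem hA.1 hA'.1, hS.inter_mem hA.2 hA'.2⟩
    · intro A hA A' hA' hsub
      rw [hrestr] at *
      exact ⟨Filter.mem_of_superset hA.1 hsub, hA'⟩
    · intro A hA
      rw [hrestr, hrestr]
      exact (U.mem_or_compl_mem A).imp (fun h => ⟨h, hA⟩) fun h => ⟨h, hS.compl_mem hA⟩
    · intro A hA hAM
      rw [hrestr]
      exact ⟨hdiag A fun a => ((hrestr _).1 (hA a)).1, hS.diagInter_mem hAM⟩
  · rw [hplay] at hA ⊢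
    exact (hBj ⟨j, hj⟩).trans hA

theorem IIWins.mono {C C' : ZFSet.{u} → Set (Filter (Pt κ))} {γ : Ordinal.{u}}
    (hC : ∀ M, C M ⊆ C' M) (h : IIWins κ C γ) : IIWins κ C' γ := by
  obtain ⟨σ, hσ⟩ := h
  exact ⟨σ, fun M i hi hM => ⟨hC _ (hσ M i hi hM).1, (hσ M i hi hM).2⟩⟩

/-- Completeness of the restriction comes from completeness of the filter `F` itself and does not
need normality. -/
theorem nSetC_subset_setC (hreg : κ.IsRegular) (M : ZFSet.{u}) : NSetC κ M ⊆ SetC κ M := by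
  rintro F ⟨h1, h2, h3, _, h5⟩
  refine ⟨h1, h2, h3, fun 𝒜 h𝒜 hcard => ?_, h5⟩
  have := h2.neBot hreg
  exact Filter.nonempty_of_mem (CardinalInterFilter.cardinal_sInter_mem 𝒜 hcard
    fun A hA => (h𝒜 hA).1)

end PPoint

/-! ### From winning strategies to the bounding number and to `P`-points -/

section Strategy

variable {κ : Cardinal.{u}}

theorem hull_mono {hκ : ℵ₀ ≤ κ} {S T : Set (Hered κ)} (hST : S ⊆ T)
    (hS : ∀ x, x ∈ hull hκ S ↔ ∃ h, InHull hκ S ⟨x, h⟩)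
    (hT : ∀ x, x ∈ hull hκ T ↔ ∃ h, InHull hκ T ⟨x, h⟩) : hull hκ S ⊆ hull hκ T := by
  intro x hx
  obtain ⟨h, hx⟩ := (hS x).1 hx
  exact (hT x).2 ⟨h, hx.mono _ (Set.insert_subset_insert hST)⟩

theorem hull_empty_spec (hunc : ℵ₀ < κ) (hpow : κ ^< κ = κ) :
    (∀ x, x ∈ hull hunc.le (∅ : Set (Hered κ)) ↔ ∃ h, InHull hunc.le ∅ ⟨x, h⟩) ∧
      (hull hunc.le (∅ : Set (Hered κ))).card ≤ κ :=
  hull_spec hunc le_rfl (fun _ hν => power_le_of_powerlt_eq hpow hν)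
    (PEmpty.elim : PEmpty.{u + 1} → Hered κ) (Set.empty_subset _) (by simp)

/-- A subset of `κ` as an element of `H(κ⁺)`. -/
def setHered (hκ : ℵ₀ ≤ κ) (A : Set (Pt κ)) : Hered κ := ⟨setCode A, heredLT_setCode hκ A⟩

theorem le_boundingNumber_of_iIWins (hreg : κ.IsRegular) (hunc : ℵ₀ < κ) (hpow : κ ^< κ = κ)
    {μ : Cardinal.{u}} (hμ : ∀ ρ : Cardinal.{u}, κ ≤ ρ → ρ < μ → ρ.IsRegular → ρ ^< κ < μ)
    (hwin : IIWins κ (SetC κ) μ.ord) : μ ≤ boundingNumber κ := by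
  classical
  by_contra! hlt
  obtain ⟨S, hSc, hS⟩ := exists_unbounded hreg
  have hb : κ ≤ boundingNumber κ := le_boundingNumber hreg
  have hθμ := hμ _ hb hlt (isRegular_boundingNumber hreg)
  set θ := boundingNumber κ ^< κ with hθ
  have hθpow : ∀ ν < κ, θ ^ ν ≤ θ := fun ν hν => powerlt_power_le hreg hb hν
  have hbθ : boundingNumber κ ≤ θ := by
    simpa using le_powerlt (boundingNumber κ)
      (show (1 : Cardinal) < κ by exact_mod_cast hreg.nat_lt 1)
  have hκθ : κ ≤ θ := hb.trans hbθ
  have hinf : ℵ₀ ≤ θ := hunc.le.trans hκθ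
  -- The diagonal intersection of `D f` is the set of points closed under `f`.
  let D : (Pt κ → Pt κ) → Pt κ → Set (Pt κ) := fun f a => {b | f a < b}
  let op : ∀ f : S, (PUnit.{u + 1} → Pt κ → Pt κ) → Pt κ → Pt κ :=
    fun f h => regress (D f.1) (h ⟨⟩)
  obtain ⟨T, e, hT, he⟩ := exists_genBy_surjection op (S := {id})
    (fun _ : PUnit.{u + 1} => (id : Pt κ → Pt κ)) (by rintro _ rfl; exact ⟨⟨⟩, rfl⟩) hinf
    (by simpa using one_le_aleph0.trans hinf) (hSc.le.trans hbθ) (fun _ => by simp)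
  -- These are exactly the sets that the minimality argument needs decided. There are at most `θ` of
  -- them because the functions involved are generated from `id` by the unary operations `regress (D
  -- f)` with `f ∈ S`.
  let c : (T × Pt κ) ⊕ (T × S) → Hered κ := Sum.elim
    (fun p => setHered hunc.le {x | e p.1 x ≤ p.2})
    (fun p => setHered hunc.le (e p.1 ⁻¹' diagInter (D p.2.1)))
  obtain ⟨hmem, hcard⟩ := hull_spec hunc hκθ hθpow c Set.Subset.rfl (by
    simp only [mk_sum, mk_prod, lift_id, mk_pt, hSc]
    exact add_le_of_le hinf (mul_le_of_le hinf hT hκθ) (mul_le_of_le hinf hT hbθ))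
  obtain ⟨hmem0, hcard0⟩ := hull_empty_spec hunc hpow
  obtain ⟨σ, hσ⟩ := hwin
  -- A model of size `θ` is sure to be legal at stage `θ`; until then Player I waits with the hull
  -- of `∅`, of size at most `κ`.
  let M : Ordinal.{u} → ZFSet.{u} := fun i =>
    if i < θ.ord then hull hunc.le ∅ else hull hunc.le (Set.range c)
  have hlegal : ∀ j ≤ θ.ord, LegalI κ M j := fun j hj => by
    rcases hj.lt_or_eq with hj | rfl
    · refine ⟨?_, ?_, fun l hl => ?_⟩
      · simp only [M, hj, if_true]
        exact isSuitable_of_forall_mem_iff hreg hunc hmem0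
      · simp only [M, hj, if_true]
        exact hcard0.trans (le_max_left _ _)
      · simp only [M, hj, hl.trans hj, if_true]
        exact fun _ h => h
    · refine ⟨?_, ?_, fun l hl => ?_⟩
      · simp only [M, lt_irrefl, if_false]
        exact isSuitable_of_forall_mem_iff hreg hunc hmem
      · simp only [M, lt_irrefl, if_false, card_ord]
        exact hcard.trans (le_max_right _ _)
      · simp only [M, lt_irrefl, hl, if_true, if_false]
        exact hull_mono (Set.empty_subset _) hmem0 hmem
  obtain ⟨⟨hF1, hF2, hF3, -, X, hX⟩, -⟩ := hσ M θ.ord (ord_lt_ord.2 hθμ) hlegal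
  set F := σ.play M θ.ord
  have hMθ : M θ.ord = hull hunc.le (Set.range c) := by simp [M]
  rw [hMθ] at hF3
  have hin : ∀ i, (c i).1 ∈ hull hunc.le (Set.range c) := fun i =>
    (hmem _).2 ⟨(c i).2, .base _ (.inr ⟨i, rfl⟩)⟩
  have hne := hF2.neBot hreg
  have hdec : ∀ A : Set (Pt κ), setCode A ∈ hull hunc.le (Set.range c) → A ∈ F ∨ Aᶜ ∈ F :=
    fun A hA => (hF3.ultra A hA).imp And.left And.left
  obtain ⟨h, -, hgt, hdiag⟩ := exists_minimal_preimage_diagInter_mem hreg hunc (F := F)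
    {h | GenBy op {id} h} (D '' S) (.base _ rfl)
    (fun a => (hX _).2 ⟨a, fun _ _ h => h⟩)
    (by
      rintro h hh _ ⟨f, hf, rfl⟩
      exact .app (op := op) ⟨f, hf⟩ (fun _ => h) fun _ => hh)
    (by
      intro h hh a
      obtain ⟨t, rfl⟩ := he h hh
      exact hdec _ (hin (.inl (t, a))))
    (by
      rintro h hh _ ⟨f, hf, rfl⟩
      obtain ⟨t, rfl⟩ := he h hh
      exact hdec _ (hin (.inr (t, ⟨f, hf⟩))))
  have hXF : X ∈ F := (hX X).2 (AlmostSubset.refl hreg X)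
  have hg : ∀ a, ∃ y ∈ h '' X, a < y := fun a => by
    obtain ⟨x, hx1, hx2⟩ := Filter.nonempty_of_mem (Filter.inter_mem hXF (hgt a))
    exact ⟨h x, ⟨x, hx1, rfl⟩, hx2⟩
  choose g hgX hag using hg
  refine hS ⟨g, fun f hf => ?_⟩
  -- From `a` on, all elements of `h '' X` are closed under `f`; since `g b > b` is one of them, `f
  -- b < g b`.
  obtain ⟨a, ha⟩ := ((hX _).1 (hdiag (D f) ⟨f, hf, rfl⟩ fun a => hgt (f a))).image hreg
  exact ⟨a, fun b hab => (ha (g b) (hgX b) (hab.trans (hag b).le) b (hag b)).le⟩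

theorem carriesPPoint_of_iIWins (hreg : κ.IsRegular) (hunc : ℵ₀ < κ) (hpow : κ ^< κ = κ)
    {ρ : Cardinal.{u}} (hρ : Order.succ ρ = 2 ^ κ) (hρpow : ∀ ν < κ, ρ ^ ν ≤ ρ)
    (hwin : IIWins κ (SetC κ) ((2 : Cardinal.{u}) ^ κ).ord) : CarriesPPoint κ (2 ^ κ) := by
  classical
  have hκρ : κ ≤ ρ := by
    rw [← Order.lt_succ_iff, hρ]
    exact cantor κ
  have hinf : ℵ₀ ≤ ρ := hunc.le.trans hκρ
  set μ : Cardinal.{u} := 2 ^ κ with hμ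
  have hregμ : μ.IsRegular := hρ ▸ isRegular_succ hinf
  obtain ⟨e⟩ : Nonempty (Pt μ ≃ Set (Pt κ)) := by
    rw [← Cardinal.eq, mk_pt, mk_set, mk_pt]
  -- All subsets of `κ` are enumerated in order type `2^κ = ρ⁺`; the model at stage `i` receives
  -- those with index at most `i`, of which there are at most `ρ`.
  let G : Ordinal.{u} → Set (Hered κ) := fun i =>
    {x | ∃ j : Pt μ, (j.toOrd : Ordinal.{u}) ≤ i ∧ x = setHered hunc.le (e j)}
  have hG : ∀ i < μ.ord, (∀ x, x ∈ hull hunc.le (G i) ↔ ∃ h, InHull hunc.le (G i) ⟨x, h⟩) ∧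
      (hull hunc.le (G i)).card ≤ ρ := fun i hi => by
    refine hull_spec hunc hκρ hρpow
      (fun j : Set.Iic (Ordinal.ToType.mk ⟨i, hi⟩ : Pt μ) => setHered hunc.le (e j)) ?_ ?_
    · rintro _ ⟨j, hj, rfl⟩
      refine ⟨⟨j, ?_⟩, rfl⟩
      rw [Set.mem_Iic, ← OrderIso.symm_apply_le]
      exact hj
    · rw [← Order.lt_succ_iff, hρ]
      exact mk_Iic_pt_lt hregμ _
  obtain ⟨hmem0, hcard0⟩ := hull_empty_spec hunc hpow
  let M : Ordinal.{u} → ZFSet.{u} := fun i =>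
    if i < ρ.ord then hull hunc.le ∅ else hull hunc.le (G i)
  have hlegal : ∀ i < μ.ord, LegalI κ M i := fun i hi => by
    by_cases hiρ : i < ρ.ord
    · refine ⟨?_, ?_, fun l hl => ?_⟩
      · simp only [M, hiρ, if_true]
        exact isSuitable_of_forall_mem_iff hreg hunc hmem0
      · simp only [M, hiρ, if_true]
        exact hcard0.trans (le_max_left _ _)
      · simp only [M, hiρ, hl.trans hiρ, if_true]
        exact fun _ h => h
    · refine ⟨?_, ?_, fun l hl => ?_⟩
      · simp only [M, hiρ, if_false]
        exact isSuitable_of_forall_mem_iff hreg hunc (hG i hi).1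
      · simp only [M, hiρ, if_false]
        exact (hG i hi).2.trans ((ord_le.1 (not_lt.1 hiρ)).trans (le_max_right _ _))
      · simp only [M, hiρ, if_false]
        split
        · exact hull_mono (Set.empty_subset _) hmem0 (hG i hi).1
        · exact hull_mono (fun x ⟨j, hj, hx⟩ => ⟨j, hj.trans hl.le, hx⟩)
            (hG l (hl.trans hi)).1 (hG i hi).1
  obtain ⟨σ, hσ⟩ := hwin
  let F : Pt μ → Filter (Pt κ) := fun i => σ.play M i.toOrd
  have hF : ∀ i : Pt μ, LegalII (SetC κ) M (σ.play M) i.toOrd := fun i =>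
    hσ M _ i.toOrd.2 fun j hj => hlegal j (hj.trans_lt i.toOrd.2)
  have hmono : ∀ i j : Pt μ, i ≤ j → ∀ A ∈ F i, A ∈ F j := fun i j hij A hA => by
    rcases hij.lt_or_eq with hij | rfl
    · exact (hF j).2 _ (Ordinal.ToType.mk.symm.lt_iff_lt.2 hij) A hA
    · exact hA
  obtain ⟨i₀⟩ := pt_nonempty hregμ
  let U₀ : Filter (Pt κ) :=
    { sets := {A | ∃ i, A ∈ F i}
      univ_sets := ⟨i₀, Filter.univ_mem⟩
      sets_of_superset := fun ⟨i, hi⟩ h => ⟨i, Filter.mem_of_superset hi h⟩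
      inter_sets := fun ⟨i, hi⟩ ⟨j, hj⟩ => ⟨max i j,
        Filter.inter_mem (hmono _ _ (le_max_left _ _) _ hi) (hmono _ _ (le_max_right _ _) _ hj)⟩ }
  have hunif : IsUniform U₀ := fun A ⟨i, hi⟩ => (hF i).1.2.1 A hi
  have hdec : ∀ A : Set (Pt κ), A ∈ U₀ ∨ Aᶜ ∈ U₀ := fun A => by
    have hρμ : ρ.ord < μ.ord := ord_lt_ord.2 (hρ ▸ Order.lt_succ ρ)
    -- The stage must be at least `ρ`, since earlier models are the waiting moves and need not
    -- contain `A`.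
    let i : Pt μ := max (e.symm A) (Ordinal.ToType.mk ⟨ρ.ord, hρμ⟩)
    have hi1 : (((e.symm A).toOrd : Set.Iio μ.ord) : Ordinal.{u}) ≤ i.toOrd :=
      Ordinal.ToType.mk.symm.monotone (le_max_left _ _)
    have hi2 : ρ.ord ≤ (i.toOrd : Ordinal.{u}) := by
      have h : (⟨ρ.ord, hρμ⟩ : Set.Iio μ.ord) ≤ i.toOrd := by
        rw [← OrderIso.symm_apply_apply Ordinal.ToType.mk (⟨ρ.ord, hρμ⟩ : Set.Iio μ.ord)]
        exact Ordinal.ToType.mk.symm.monotone (le_max_right _ _)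
      exact h
    have hMi : M i.toOrd = hull hunc.le (G i.toOrd) := if_neg hi2.not_gt
    have hA : A ∈ powerIn κ (M i.toOrd) := by
      rw [hMi]
      refine ((hG _ i.toOrd.2).1 _).2 ⟨heredLT_setCode hunc.le A, .base _ (.inr ?_)⟩
      exact ⟨e.symm A, hi1, Subtype.ext (by simp [setHered])⟩
    exact ((hF i).1.2.2.1.ultra A hA).imp (fun h => ⟨i, h.1⟩) fun h => ⟨i, h.1⟩
  have hbot := hunif.neBot hreg
  let U : Ultrafilter (Pt κ) := Ultrafilter.ofComplNotMemIff U₀ fun A =>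
    ⟨fun h => (hdec A).resolve_right h, fun h h' => by
      have := Filter.inter_mem h h'
      rw [Set.inter_compl_self] at this
      exact Filter.empty_notMem U₀ this⟩
  refine ⟨U, hunif, fun 𝒜 h𝒜 hcard => ?_⟩
  choose f hf using fun A : 𝒜 => (h𝒜 A.1 A.2 : ∃ i, A.1 ∈ F i)
  have hcard' : #𝒜 < μ := hcard
  -- Regularity of `2^κ` puts all of `𝒜` into one reply, whose generator is the required
  -- pseudo-intersection.
  obtain ⟨i, hi⟩ := exists_forall_lt_of_mk_lt hregμ hcard' f
  obtain ⟨X, hX⟩ := (hF i).1.2.2.2.2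
  exact ⟨X, ⟨i, (hX X).2 (AlmostSubset.refl hreg X)⟩,
    fun A hA => (hX A).1 (hmono _ _ (hi ⟨A, hA⟩).le _ (hf ⟨A, hA⟩))⟩

end Strategy

end FilterGame

end

theorem mainTheorem7 (κ : Cardinal.{u}) (hreg : κ.IsRegular) (hunc : ℵ₀ < κ) :
    (FilterGame.CarriesPPoint κ ((2 : Cardinal.{u}) ^ κ) →
      FilterGame.IIWins κ (FilterGame.NSetC κ) ((2 : Cardinal.{u}) ^ κ).ord) ∧
    (FilterGame.IIWins κ (FilterGame.NSetC κ) ((2 : Cardinal.{u}) ^ κ).ord →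
      FilterGame.IIWins κ (FilterGame.SetC κ) ((2 : Cardinal.{u}) ^ κ).ord) ∧
    (κ ^< κ = κ →
      (∀ ρ : Cardinal.{u}, κ ≤ ρ → ρ < (2 : Cardinal.{u}) ^ κ → ρ ^< κ < (2 : Cardinal.{u}) ^ κ) →
      ¬ (((2 : Cardinal.{u}) ^ κ).IsRegular ∧ Order.IsSuccLimit ((2 : Cardinal.{u}) ^ κ)) →
      [FilterGame.IIWins κ (FilterGame.NSetC κ) ((2 : Cardinal.{u}) ^ κ).ord,
        FilterGame.IIWins κ (FilterGame.SetC κ) ((2 : Cardinal.{u}) ^ κ).ord,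
        FilterGame.CarriesPPoint κ ((2 : Cardinal.{u}) ^ κ)].TFAE) ∧
    (κ ^< κ = κ →
      ∀ μ : Cardinal.{u},
        (∀ ρ : Cardinal.{u}, κ ≤ ρ → ρ < μ → ρ.IsRegular → ρ ^< κ < μ) →
        FilterGame.IIWins κ (FilterGame.SetC κ) μ.ord →
        μ ≤ FilterGame.boundingNumber κ) := by
  have h31 := FilterGame.iIWins_of_pPoint hreg hunc (cantor κ)
  have h12 := FilterGame.IIWins.mono (γ := ((2 : Cardinal.{u}) ^ κ).ord)
    (FilterGame.nSetC_subset_setC hreg)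
  have hc := fun hpow {μ} => FilterGame.le_boundingNumber_of_iIWins (μ := μ) hreg hunc hpow
  refine ⟨h31, h12, fun hpow hρ hlim => ?_, fun hpow μ => hc hpow⟩
  tfae_have 3 → 1 := h31
  tfae_have 1 → 2 := h12
  tfae_have 2 → 3 := fun hwin => by
    -- Part (c) enters only to make `2^κ` regular, which leaves the successor case.
    have hb : (2 : Cardinal.{u}) ^ κ = FilterGame.boundingNumber κ :=
      le_antisymm (hc hpow (fun ρ h1 h2 _ => hρ ρ h1 h2) hwin)
        (FilterGame.boundingNumber_le hreg)
    have hregular : ((2 : Cardinal.{u}) ^ κ).IsRegular :=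
      hb ▸ FilterGame.isRegular_boundingNumber hreg
    have hpre : ¬ Order.IsSuccPrelimit ((2 : Cardinal.{u}) ^ κ) := fun h =>
      hlim ⟨hregular, fun hmin => hregular.ne_zero hmin.eq_bot, h⟩
    obtain ⟨ρ, hρ'⟩ := Order.not_isSuccPrelimit_iff_mem_range_succ.1 hpre
    have hρlt : ρ < 2 ^ κ := hρ' ▸ Order.lt_succ ρ
    have hκρ : κ ≤ ρ := by
      rw [← Order.lt_succ_iff, hρ']
      exact cantor κ
    refine FilterGame.carriesPPoint_of_iIWins hreg hunc hpow hρ' (fun ν hν => ?_) hwin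
    rw [← Order.lt_succ_iff, hρ']
    exact (le_powerlt ρ hν).trans_lt (hρ ρ hκρ hρlt)
  tfae_finish
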